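/- A Banach Lie algebra is a complex Lie algebra $L$ that is a Banach space in some norm for which there is a constant $t>0$ with $\|[a,b]\|\le t\|a\|\,\|b\|$ for all $a,b\in L$. For a Banach Lie algebra $L$ let $\mathfrak S_L$ be the family of all proper closed Lie subalgebras of finite codimension in $L$, let $\mathfrak J_L$ be the family of all proper closed Lie ideals of finite codimension, and let $\mathfrak S_L^{\max}$ and $\mathfrak J_L^{\max}$ be the families of all maximal proper closed Lie subalgebras, respectively Lie ideals, of finite codimension. For each of these families $\Gamma$ let $P_\Gamma(L)$ be the intersection of all members of $\Gamma_L$, with $P_\Gamma(L)=L$ if $\Gamma_L=\emptyset$. A preradical is a map $R$ that assigns to every Banach Lie algebra $L$ a closed Lie ideal $R(L)$ of $L$ such that $f(R(L))\subseteq R(M)$ for every bounded Lie homomorphism $f:L\to M$ of Banach Lie algebras with dense image. A radical is a preradical $R$ such that, for every $L$: $R(R(L))=R(L)$, $R(L/R(L))=\{0\}$, and $R(I)\subseteq R(L)$ for every closed Lie ideal $I$ of $L$. For a preradical $R$ put $R^0(L)=L$, $R^{\alpha+1}(L)=R(R^\alpha(L))$ for every ordinal $\alpha$, and $R^\alpha(L)=\bigcap_{\alpha'<\alpha}R^{\alpha'}(L)$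 for every limit ordinal $\alpha$. Let $r_R^\circ(L)$ be the least ordinal $\beta$ with $R^{\beta+1}(L)=R^\beta(L)$, and put $R^\circ(L)=R^{r_R^\circ(L)}(L)$. **Theorem 7.8.** The maps $P_{\mathfrak S}$, $P_{\mathfrak J}$, $P_{\mathfrak S^{\max}}$, $P_{\mathfrak J^{\max}}$ are preradicals, and the following hold. (i) For every Banach Lie algebra $L$, $$P_{\mathfrak S}(L)\subseteq P_{\mathfrak J}(L)\subseteq P_{\mathfrak S^{\max}}(L)\subseteq P_{\mathfrak J^{\max}}(L).$$ If $\mathfrak S_L\neq\emptyset$, then $P_{\mathfrak J^{\max}}(L)\neq L$. (ii) The maps $P_{\mathfrak S}^\circ$, $P_{\mathfrak J}^\circ$, $P_{\mathfrak S^{\max}}^\circ$ and $P_{\mathfrak J^{\max}}^\circ$ are radicals and they coincide. (The common radical $\mathcal F$ is called the Frattini radical.) (iii) For every Banach Lie algebra $L$, $$r^\circ_{P_{\mathfrak S}}(L)\le r^\circ_{P_{\mathfrak J}}(L)\le r^\circ_{P_{\mathfrak S^{\max}}}(L)\le r^\circ_{P_{\mathfrak J^{\max}}}(L).$$ -/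

import Mathlib

universe u

/-- A complex Banach Lie algebra: a complex Lie algebra that is a Banach space for some norm and
whose bracket satisfies `‖⁅a, b⁆‖ ≤ t * ‖a‖ * ‖b‖` for some constant `t > 0`. -/
class BanachLieAlgebra (L : Type u) extends NormedAddCommGroup L, LieRing L, NormedSpace ℂ L,
    LieAlgebra ℂ L, CompleteSpace L where
  exists_norm_lie_le : ∃ t : ℝ, 0 < t ∧ ∀ a b : L, ‖⁅a, b⁆‖ ≤ t * ‖a‖ * ‖b‖

/-- A closed Lie subalgebra of a Banach Lie algebra. -/
@[ext]
structure ClosedLieSubalgebra (L : Type u) [BanachLieAlgebra L] where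
  toLieSubalgebra : LieSubalgebra ℂ L
  isClosed : IsClosed (toLieSubalgebra : Set L)

namespace ClosedLieSubalgebra

variable {L : Type u} [BanachLieAlgebra L]

/-- Closed Lie subalgebras are ordered by inclusion. -/
instance : PartialOrder (ClosedLieSubalgebra L) :=
  PartialOrder.lift toLieSubalgebra fun _ _ h => ClosedLieSubalgebra.ext h

theorem le_def {S T : ClosedLieSubalgebra L} :
    S ≤ T ↔ S.toLieSubalgebra ≤ T.toLieSubalgebra := Iff.rfl

/-- The whole algebra. -/
instance : Top (ClosedLieSubalgebra L) := ⟨⟨⊤, by simp⟩⟩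

/-- The zero subalgebra. -/
instance : Bot (ClosedLieSubalgebra L) := ⟨⟨⊥, by simp⟩⟩

/-- The intersection of a family of closed Lie subalgebras; it is the whole algebra when the
family is empty. -/
instance : InfSet (ClosedLieSubalgebra L) where
  sInf F := ⟨sInf (toLieSubalgebra '' F), by
    rw [LieSubalgebra.coe_sInf]
    refine isClosed_biInter ?_
    rintro _ ⟨S, -, rfl⟩
    exact S.isClosed⟩

theorem mem_sInf {F : Set (ClosedLieSubalgebra L)} {x : L} :
    x ∈ (sInf F).toLieSubalgebra ↔ ∀ S ∈ F, x ∈ S.toLieSubalgebra := by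
  change x ∈ sInf (toLieSubalgebra '' F) ↔ _
  rw [← SetLike.mem_coe, LieSubalgebra.coe_sInf]
  simp

theorem le_top' (S : ClosedLieSubalgebra L) : S ≤ ⊤ := fun _ _ => LieSubalgebra.mem_top _

/-- A closed Lie subalgebra is itself a Banach Lie algebra, with the restricted norm. -/
noncomputable instance instBanachLieAlgebra (S : ClosedLieSubalgebra L) :
    BanachLieAlgebra S.toLieSubalgebra :=
  { Submodule.normedAddCommGroup S.toLieSubalgebra.toSubmodule,
    LieSubalgebra.lieRing ℂ L S.toLieSubalgebra,
    Submodule.normedSpace S.toLieSubalgebra.toSubmodule,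
    LieSubalgebra.lieAlgebra ℂ L S.toLieSubalgebra with
    toCompleteSpace := S.isClosed.completeSpace_coe
    exists_norm_lie_le := by
      obtain ⟨t, ht, h⟩ := BanachLieAlgebra.exists_norm_lie_le (L := L)
      exact ⟨t, ht, fun a b => h a b⟩ }

/-- A closed Lie subalgebra of the closed Lie subalgebra `S` of `L`, regarded as a closed Lie
subalgebra of `L`. -/
def ofSub (S : ClosedLieSubalgebra L) (T : ClosedLieSubalgebra S.toLieSubalgebra) :
    ClosedLieSubalgebra L where
  toLieSubalgebra := T.toLieSubalgebra.map S.toLieSubalgebra.incl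
  isClosed := by
    have h : ((T.toLieSubalgebra.map S.toLieSubalgebra.incl : LieSubalgebra ℂ L) : Set L) =
        Subtype.val '' (T.toLieSubalgebra : Set S.toLieSubalgebra) := by
      ext x; simp
    rw [h]
    exact S.isClosed.isClosedEmbedding_subtypeVal.isClosedMap _ T.isClosed

theorem ofSub_le (S : ClosedLieSubalgebra L) (T : ClosedLieSubalgebra S.toLieSubalgebra) :
    S.ofSub T ≤ S := by
  rintro _ ⟨y, -, rfl⟩
  exact y.2

/-- `S` is a Lie ideal. -/
def IsIdeal (S : ClosedLieSubalgebra L) : Prop :=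
  ∀ x y : L, y ∈ S.toLieSubalgebra → ⁅x, y⁆ ∈ S.toLieSubalgebra

/-- `S` has finite codimension. -/
def FiniteCodim (S : ClosedLieSubalgebra L) : Prop :=
  FiniteDimensional ℂ (L ⧸ S.toLieSubalgebra.toSubmodule)

/-- A closed Lie subalgebra that is a Lie ideal, as a Lie ideal in Mathlib's sense. -/
def toLieIdeal (S : ClosedLieSubalgebra L) (hS : S.IsIdeal) : LieIdeal ℂ L where
  toSubmodule := S.toLieSubalgebra.toSubmodule
  lie_mem := fun {x y} h => hS x y h

/-- The quotient of a Banach Lie algebra by a closed Lie ideal is a Banach Lie algebra, with the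
quotient norm. -/
noncomputable instance instBanachLieAlgebraQuotient (S : ClosedLieSubalgebra L) (hS : S.IsIdeal) :
    BanachLieAlgebra (L ⧸ S.toLieIdeal hS) :=
  haveI : IsClosed ((S.toLieIdeal hS).toSubmodule : Set L) := S.isClosed
  { Submodule.Quotient.normedAddCommGroup (S.toLieIdeal hS).toSubmodule,
    LieSubmodule.Quotient.lieQuotientLieRing (I := S.toLieIdeal hS),
    Submodule.Quotient.normedSpace (S.toLieIdeal hS).toSubmodule ℂ,
    LieSubmodule.Quotient.lieQuotientLieAlgebra (I := S.toLieIdeal hS) with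
    toCompleteSpace := Submodule.Quotient.completeSpace (S.toLieIdeal hS).toSubmodule
    exists_norm_lie_le := by
      obtain ⟨t, ht, h⟩ := BanachLieAlgebra.exists_norm_lie_le (L := L)
      refine ⟨t, ht, fun a b => ?_⟩
      let _ : Norm (L ⧸ S.toLieIdeal hS) :=
        inferInstanceAs (Norm (L ⧸ (S.toLieIdeal hS).toSubmodule))
      have key : ∀ ε : ℝ, 0 < ε → ‖⁅a, b⁆‖ ≤ t * (‖a‖ + ε) * (‖b‖ + ε) := by
        intro ε hε
        obtain ⟨x, rfl, hx⟩ := Submodule.Quotient.norm_mk_lt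
          (S := (S.toLieIdeal hS).toSubmodule) a hε
        obtain ⟨y, rfl, hy⟩ := Submodule.Quotient.norm_mk_lt
          (S := (S.toLieIdeal hS).toSubmodule) b hε
        refine (Submodule.Quotient.norm_mk_le
          (S := (S.toLieIdeal hS).toSubmodule) ⁅x, y⁆).trans ?_
        refine (h x y).trans ?_
        have h0 : 0 ≤ t * (‖(Submodule.Quotient.mk x :
            L ⧸ (S.toLieIdeal hS).toSubmodule)‖ + ε) :=
          mul_nonneg ht.le ((norm_nonneg x).trans hx.le)
        exact mul_le_mul (mul_le_mul_of_nonneg_left hx.le ht.le) hy.le (norm_nonneg y) h0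
      have hc : Continuous fun ε : ℝ => t * (‖a‖ + ε) * (‖b‖ + ε) := by fun_prop
      have hlim := (hc.tendsto 0).mono_left (nhdsWithin_le_nhds (s := Set.Ioi (0 : ℝ)))
      simp only [add_zero] at hlim
      exact ge_of_tendsto hlim (Filter.eventually_of_mem self_mem_nhdsWithin key) }

end ClosedLieSubalgebra

/-- A map assigning to every Banach Lie algebra one of its closed Lie subalgebras. -/
abbrev SubalgebraMap : Type (u + 1) :=
  ∀ (L : Type u) [BanachLieAlgebra L], ClosedLieSubalgebra L

namespace SubalgebraMap

/-- A preradical: the values are closed Lie ideals, and `f (R L) ⊆ R M` for every bounded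
homomorphism `f : L → M` with dense image. -/
structure IsPreradical (R : SubalgebraMap.{u}) : Prop where
  isIdeal : ∀ (L : Type u) [BanachLieAlgebra L], (R L).IsIdeal
  map_mem : ∀ (L M : Type u) [BanachLieAlgebra L] [BanachLieAlgebra M] (f : L →ₗ⁅ℂ⁆ M),
    Continuous f → DenseRange f → ∀ x ∈ (R L).toLieSubalgebra, f x ∈ (R M).toLieSubalgebra

/-- A radical: a preradical that is lower stable, `R (R L) = R L`, upper stable, `R (L / R L) = 0`,
and balanced, `R I ⊆ R L` for every closed Lie ideal `I` of `L`. -/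
structure IsRadical (R : SubalgebraMap.{u}) : Prop extends IsPreradical R where
  lowerStable : ∀ (L : Type u) [BanachLieAlgebra L], (R L).ofSub (R (R L).toLieSubalgebra) = R L
  upperStable : ∀ (L : Type u) [BanachLieAlgebra L],
    R (L ⧸ (R L).toLieIdeal (isIdeal L)) = ⊥
  balanced : ∀ (L : Type u) [BanachLieAlgebra L] (I : ClosedLieSubalgebra L), I.IsIdeal →
    I.ofSub (R I.toLieSubalgebra) ≤ R L

/-- The superposition series: `R^0 L = L`, `R^(α+1) L = R (R^α L)`, and `R^α L` is the
intersection of all `R^β L` with `β < α` when `α` is a limit ordinal. -/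
noncomputable def series (R : SubalgebraMap.{u}) (L : Type u) [BanachLieAlgebra L]
    (α : Ordinal.{u}) : ClosedLieSubalgebra L :=
  Ordinal.limitRecOn α ⊤ (fun _ S => S.ofSub (R S.toLieSubalgebra))
    (fun α _ S => sInf {T | ∃ (β : Ordinal.{u}) (h : β < α), T = S β h})

section

variable (R : SubalgebraMap.{u}) (L : Type u) [BanachLieAlgebra L]

theorem series_zero : R.series L 0 = ⊤ := by
  simp [series]

theorem series_succ (α : Ordinal.{u}) :
    R.series L (α + 1) = (R.series L α).ofSub (R (R.series L α).toLieSubalgebra) := by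
  rw [series, Ordinal.limitRecOn_add_one]
  rfl

theorem series_limit {α : Ordinal.{u}} (h : Order.IsSuccLimit α) :
    R.series L α = sInf {T | ∃ β < α, T = R.series L β} := by
  simp [series, h]

theorem series_antitone : Antitone (R.series L) := by
  intro β α
  induction α using Ordinal.limitRecOn with
  | zero =>
    intro h
    rw [nonpos_iff_eq_zero.1 h]
  | add_one α ih =>
    intro h
    rcases h.lt_or_eq with h | h
    · rw [series_succ]
      exact (ClosedLieSubalgebra.ofSub_le _ _).trans (ih (Order.lt_add_one_iff.1 h))
    · rw [h]
  | limit α hα _ =>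
    intro h
    rcases h.lt_or_eq with h | h
    · rw [series_limit R L hα]
      exact fun x hx => ClosedLieSubalgebra.mem_sInf.1 hx _ ⟨β, h, rfl⟩
    · rw [h]

/-- The superposition series stabilizes. -/
theorem exists_series_stable : ∃ β : Ordinal.{u}, R.series L (β + 1) = R.series L β := by
  by_contra hne
  simp only [not_exists] at hne
  have hanti : StrictAnti (R.series L) := by
    intro α β h
    refine (series_antitone R L (Order.add_one_le_of_lt h)).trans_lt ?_
    exact lt_of_le_of_ne (series_antitone R L (Order.le_succ α)) (hne α)
  exact not_injective_of_ordinal _ hanti.injective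

end

/-- The length of the superposition series: the least `β` with `R^(β+1) L = R^β L`. -/
noncomputable def length (R : SubalgebraMap.{u}) (L : Type u) [BanachLieAlgebra L] :
    Ordinal.{u} :=
  sInf {β | R.series L (β + 1) = R.series L β}

theorem series_length_add_one (R : SubalgebraMap.{u}) (L : Type u) [BanachLieAlgebra L] :
    R.series L (R.length L + 1) = R.series L (R.length L) :=
  csInf_mem (s := {β | R.series L (β + 1) = R.series L β}) (exists_series_stable R L)

/-- The stable value `R° L` of the superposition series. -/
noncomputable def superposition (R : SubalgebraMap.{u}) : SubalgebraMap.{u} :=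
  fun L _ => R.series L (R.length L)

end SubalgebraMap

section Families

variable (L : Type u) [BanachLieAlgebra L]

/-- The proper closed Lie subalgebras of finite codimension. -/
def properSubalgebras : Set (ClosedLieSubalgebra L) :=
  {S | S ≠ ⊤ ∧ S.FiniteCodim}

/-- The maximal proper closed Lie subalgebras of finite codimension. -/
def maximalSubalgebras : Set (ClosedLieSubalgebra L) :=
  {S | Maximal (fun T : ClosedLieSubalgebra L => T ≠ ⊤) S ∧ S.FiniteCodim}

/-- The proper closed Lie ideals of finite codimension. -/
def properIdeals : Set (ClosedLieSubalgebra L) :=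
  {S | S.IsIdeal ∧ S ≠ ⊤ ∧ S.FiniteCodim}

/-- The maximal proper closed Lie ideals of finite codimension. -/
def maximalIdeals : Set (ClosedLieSubalgebra L) :=
  {S | Maximal (fun T : ClosedLieSubalgebra L => T.IsIdeal ∧ T ≠ ⊤) S ∧ S.FiniteCodim}

end Families

/-- The intersection of all proper closed Lie subalgebras of finite codimension. -/
def preradS : SubalgebraMap.{u} := fun L _ => sInf (properSubalgebras L)

/-- The intersection of all proper closed Lie ideals of finite codimension. -/
def preradJ : SubalgebraMap.{u} := fun L _ => sInf (properIdeals L)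

/-- The intersection of all maximal proper closed Lie subalgebras of finite codimension. -/
def preradSmax : SubalgebraMap.{u} := fun L _ => sInf (maximalSubalgebras L)

/-- The intersection of all maximal proper closed Lie ideals of finite codimension. -/
def preradJmax : SubalgebraMap.{u} := fun L _ => sInf (maximalIdeals L)

/-- The Frattini radical: the radical obtained by superposition from the intersection of the
proper closed Lie subalgebras of finite codimension. -/
noncomputable def frattiniRadical : SubalgebraMap.{u} := preradS.superposition

/-! The analytic heart is `exists_isIdeal_le_of_maximal`: a maximal closed subalgebra M of finite
codimension contains a closed ideal of finite codimension. If M acts nilpotently on a minimal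
submodule of L/M, Engel's theorem gives v outside M with [M, v] ⊆ M; then M + ℂv is a subalgebra,
hence L, and M itself is an ideal. Otherwise take E above M with E/M minimal, and h in M, y in E
with [h, y] ≡ cy mod M, c ≠ 0. Put H₀ = M and let Hₙ₊₁ be the set of x in Hₙ with [E, x] ⊆ Hₙ; all
Hₙ are closed of finite codimension. On the graded pieces (ad y)^k is an eigenvector of the
commutator with ad h for the eigenvalue kc. Since ad h is bounded, it vanishes for large k, so y
acts nilpotently. The automorphisms exp(ad m), m in M, carry y to further such elements, and by
minimality these span E modulo M. The brackets of E yield a graded Lie algebra of operators,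
finite-dimensional in positive degrees, generated in degree one and spanned there by nilpotents;
long products of its degree-one elements vanish. Hence H_K = H_{K+1} for some K. The normalizer of
H_K then contains E, so it is L by maximality, and H_K is the ideal sought.

This gives P_𝔍 ⊆ P_{𝔖^max} and shows that all four maps are proper on L as soon as 𝔖_L is nonempty.
The radicals then coincide for a formal reason. Call N saturated if 𝔖_N is empty. For each of the
four maps R, the algebra R°(L) is saturated, and every continuous homomorphism from a saturated N to
L has its image in R°(L) (`map_mem_superposition`). So R°(L) is the largest saturated closed
subalgebra, whatever R is, and the radical axioms follow from this property together with the
stability of saturation under extensions (`properSubalgebras_comap_quotientMap`). Lengths are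
compared by squeezing one superposition series under another with the same final value. -/

/-! ### Closed subspaces and exponentials of bounded operators -/

section ExpInvariance

variable {E : Type*} [NormedAddCommGroup E] [NormedSpace ℂ E] [CompleteSpace E]

open NormedSpace in
/-- A closed subspace invariant under a bounded operator is invariant under its exponential. -/
theorem exp_apply_mem_of_invariant {T : Submodule ℂ E} (hT : IsClosed (T : Set E)) {D : E →L[ℂ] E}
    (hD : ∀ x ∈ T, D x ∈ T) {x : E} (hx : x ∈ T) : exp D x ∈ T := by
  have h1 : ∀ n : ℕ, (D ^ n) x ∈ T := by
    intro n
    induction n with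
    | zero => simpa
    | succ n ih => rw [pow_succ']; exact hD _ ih
  have h2 := (exp_series_hasSum_exp' (𝕂 := ℂ) D).mapL (ContinuousLinearMap.apply ℂ E x)
  refine hT.mem_of_tendsto h2 (Filter.Eventually.of_forall fun s => ?_)
  refine T.sum_mem fun n _ => ?_
  simpa using T.smul_mem _ (h1 n)

open NormedSpace in
/-- A closed subspace invariant under a one-parameter group is invariant under its generator. -/
theorem apply_mem_of_exp_invariant {T : Submodule ℂ E} (hT : IsClosed (T : Set E)) {D : E →L[ℂ] E}
    {x : E} (hD : ∀ t : ℂ, exp (t • D) x ∈ T) : D x ∈ T := by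
  have h1 : HasDerivAt (fun t : ℂ => exp (t • D) x) (D x) 0 := by
    have h := (hasDerivAt_exp_smul_const (𝕂 := ℂ) D 0).clm_apply (hasDerivAt_const 0 x)
    simpa using h
  have h2 := h1.tendsto_slope
  refine hT.mem_of_tendsto h2 (Filter.Eventually.of_forall fun t => ?_)
  rw [slope_def_module]
  exact T.smul_mem _ (T.sub_mem (hD _) (hD _))

open NormedSpace in
theorem exp_neg_apply_exp_apply (D : E →L[ℂ] E) (x : E) : exp (-D) (exp D x) = x := by
  let _ := NormedAlgebra.restrictScalars ℚ ℂ (E →L[ℂ] E)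
  have h : exp (-D) * exp D = 1 := by
    rw [← exp_add_of_commute (Commute.neg_left (Commute.refl D))]
    simp
  exact congrArg (fun T : E →L[ℂ] E => T x) h

open NormedSpace in
theorem exp_apply_exp_neg_apply (D : E →L[ℂ] E) (x : E) : exp D (exp (-D) x) = x := by
  simpa using exp_neg_apply_exp_apply (-D) x

end ExpInvariance

/-! ### Inner automorphisms -/

namespace BanachLieAlgebra

variable {L : Type u} [BanachLieAlgebra L]

variable (L) in
/-- The bracket of a Banach Lie algebra as a continuous bilinear map. -/
noncomputable def bracketCLM : L →L[ℂ] L →L[ℂ] L :=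
  LinearMap.mkContinuous₂ (LieAlgebra.ad ℂ L : L →ₗ[ℂ] Module.End ℂ L)
    (exists_norm_lie_le (L := L)).choose (exists_norm_lie_le (L := L)).choose_spec.2

@[simp]
theorem bracketCLM_apply (x y : L) : bracketCLM L x y = ⁅x, y⁆ := rfl

open NormedSpace in
-- With D = ad x, the curve F(t) = exp(-tD)[exp(tD)a, exp(tD)b] has zero derivative because D is a
-- derivation. Comparing t = 0 with t = 1 gives the claim.
theorem exp_bracketCLM_lie (x a b : L) :
    exp (bracketCLM L x) ⁅a, b⁆ = ⁅exp (bracketCLM L x) a, exp (bracketCLM L x) b⁆ := by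
  set D := bracketCLM L x with hD
  let F : ℂ → L := fun t =>
    exp (t • -D) (bracketCLM L (exp (t • D) a) (exp (t • D) b))
  have hU : ∀ (c : L) (t : ℂ), HasDerivAt (fun t : ℂ => exp (t • D) c) (D (exp (t • D) c)) t := by
    intro c t
    have h := (hasDerivAt_exp_smul_const' (𝕂 := ℂ) D t).clm_apply (hasDerivAt_const t c)
    simpa using h
  have hF : ∀ t, HasDerivAt F 0 t := by
    intro t
    have h1 := ((bracketCLM L).hasFDerivAt.comp_hasDerivAt t (hU a t)).clm_apply (hU b t)
    have h2 := (hasDerivAt_exp_smul_const (𝕂 := ℂ) (-D) t).clm_apply h1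
    refine h2.congr_deriv ?_
    change exp (t • -D) (-⁅x, ⁅exp (t • D) a, exp (t • D) b⁆⁆) +
      exp (t • -D) (⁅⁅x, exp (t • D) a⁆, exp (t • D) b⁆ + ⁅exp (t • D) a, ⁅x, exp (t • D) b⁆⁆) = 0
    rw [← map_add, ← leibniz_lie, neg_add_cancel, map_zero]
  have hconst : F 1 = F 0 :=
    is_const_of_deriv_eq_zero (fun t => (hF t).differentiableAt) (fun t => (hF t).deriv) 1 0
  simp only [F, one_smul, zero_smul, exp_zero, one_apply_eq_self,
    bracketCLM_apply] at hconst
  rw [← hconst, exp_apply_exp_neg_apply]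

open NormedSpace in
/-- The inner automorphism `exp (ad x)`. -/
noncomputable def innerAut (x : L) : L →ₗ⁅ℂ⁆ L where
  toLinearMap := (exp (bracketCLM L x) : L →L[ℂ] L)
  map_lie' := exp_bracketCLM_lie x _ _

open NormedSpace in
theorem innerAut_apply (x y : L) : innerAut x y = exp (bracketCLM L x) y := rfl

theorem continuous_innerAut (x : L) : Continuous (innerAut x) :=
  (NormedSpace.exp (bracketCLM L x) : L →L[ℂ] L).continuous

theorem innerAut_innerAut_neg (x y : L) : innerAut x (innerAut (-x) y) = y := by
  rw [innerAut_apply, innerAut_apply, map_neg, exp_apply_exp_neg_apply]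

theorem innerAut_mem {T : Submodule ℂ L} (hT : IsClosed (T : Set L)) {x : L}
    (hx : ∀ y ∈ T, ⁅x, y⁆ ∈ T) {y : L} (hy : y ∈ T) : innerAut x y ∈ T :=
  exp_apply_mem_of_invariant hT hx hy

theorem lie_mem_of_innerAut_mem {T : Submodule ℂ L} (hT : IsClosed (T : Set L)) {x y : L}
    (h : ∀ t : ℂ, innerAut (t • x) y ∈ T) : ⁅x, y⁆ ∈ T := by
  refine apply_mem_of_exp_invariant hT (D := bracketCLM L x) fun t => ?_
  have := h t
  rwa [innerAut_apply, map_smul] at this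

end BanachLieAlgebra

/-! ### Associative algebras generated by nilpotent elements of a graded Lie algebra -/

section NilpotentGeneration

theorem commutator_pow_succ {A : Type*} [Ring A] {w v u : A} (hu : w * v - v * w = u)
    (huv : Commute u v) (m : ℕ) : w * v ^ (m + 1) - v ^ (m + 1) * w = (m + 1) • (v ^ m * u) := by
  induction m with
  | zero => simpa using hu
  | succ m ih =>
    have h1 : w * v ^ (m + 1 + 1) - v ^ (m + 1 + 1) * w =
        (w * v ^ (m + 1) - v ^ (m + 1) * w) * v + v ^ (m + 1) * (w * v - v * w) := by
      rw [pow_succ v (m + 1)]; noncomm_ring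
    rw [h1, ih, hu, smul_mul_assoc, mul_assoc, huv.eq, ← mul_assoc, ← pow_succ,
      add_smul (m + 1) 1, one_smul]

/-- If the commutator of `w` with a nilpotent `v` commutes with both, it is nilpotent. -/
theorem isNilpotent_commutator {A : Type*} [Ring A] [Algebra ℂ A] {w v u : A}
    (hu : w * v - v * w = u) (huv : Commute u v) (huw : Commute u w) (hv : IsNilpotent v) :
    IsNilpotent u := by
  obtain ⟨k, hk⟩ := hv
  -- Commuting `w` past a power of `v` trades one factor `v` for a factor `u`, up to a positive
  -- integer, which is invertible over ℂ. After `k` trades only `u ^ k` is left.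
  have key : ∀ j, j ≤ k → v ^ (k - j) * u ^ j = 0 := by
    intro j
    induction j with
    | zero => simpa using hk
    | succ j ih =>
      intro hj
      have h1 := ih (by omega)
      obtain ⟨m, hm⟩ : ∃ m, k - j = m + 1 := ⟨k - j - 1, by omega⟩
      rw [hm] at h1
      have h2 : (w * v ^ (m + 1) - v ^ (m + 1) * w) * u ^ j = 0 := by
        rw [sub_mul, mul_assoc, h1, mul_assoc, ← (huw.pow_left j).eq, ← mul_assoc, h1]
        simp
      rw [commutator_pow_succ hu huv, smul_mul_assoc, mul_assoc, ← pow_succ',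
        ← Nat.cast_smul_eq_nsmul ℂ] at h2
      have h3 := (smul_eq_zero.1 h2).resolve_left (by exact_mod_cast Nat.succ_ne_zero m)
      rwa [show k - (j + 1) = m by omega]
  exact ⟨k, by simpa using key k le_rfl⟩

/-- Cut the product into `m` blocks of length `K`; each block contributes one factor `z`, and the
factors are collected on the right because `z` is central. -/
theorem list_prod_eq_mul_pow {A : Type*} [Monoid A] {S : Set A} {z : A}
    (hz : ∀ a, Commute z a) {K : ℕ}
    (h : ∀ l : List A, (∀ x ∈ l, x ∈ S) → l.length = K → ∃ a, l.prod = a * z) (m : ℕ) :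
    ∀ l : List A, (∀ x ∈ l, x ∈ S) → l.length = m * K → ∃ a, l.prod = a * z ^ m := by
  induction m with
  | zero => intro l _ _; exact ⟨l.prod, by simp⟩
  | succ m ih =>
    intro l hl hlen
    obtain ⟨a, ha⟩ := h (l.take K) (fun x hx => hl x (List.mem_of_mem_take hx))
      (by rw [List.length_take, hlen]; exact min_eq_left (by nlinarith))
    obtain ⟨b, hb⟩ := ih (l.drop K) (fun x hx => hl x (List.mem_of_mem_drop hx))
      (by rw [List.length_drop, hlen, Nat.succ_mul]; omega)
    refine ⟨a * b, ?_⟩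
    rw [← List.prod_take_mul_prod_drop l K, ha, hb, mul_assoc, ← mul_assoc z, (hz b).eq, pow_succ',
      mul_assoc, mul_assoc]

/-- An algebra generated by the degree-one part of a finite-dimensional positively graded Lie
algebra, itself generated in degree one and spanned there by nilpotent elements, has a nilpotent
augmentation ideal. -/
theorem exists_list_prod_eq_zero (d : ℕ) : ∀ (A : Type u) [Ring A] [Algebra ℂ A]
    (n : ℕ → Submodule ℂ A) (X : Set A) (q : ℕ),
    (∀ j k, 1 ≤ j → 1 ≤ k → ∀ x ∈ n j, ∀ y ∈ n k, x * y - y * x ∈ n (j + k)) →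
    (∀ j, 1 ≤ j → n (j + 1) ≤
      Submodule.span ℂ {a | ∃ v ∈ X, ∃ w ∈ n j, a = w * v - v * w}) →
    n 1 = Submodule.span ℂ X →
    (∀ v ∈ X, IsNilpotent v) →
    (∀ j, q < j → n j = ⊥) →
    (∀ j, Module.Finite ℂ (n j)) →
    Algebra.adjoin ℂ X = ⊤ →
    ∑ j ∈ Finset.Icc 1 q, Module.finrank ℂ (n j) ≤ d →
    ∃ K, ∀ l : List A, (∀ x ∈ l, x ∈ n 1) → l.length = K → l.prod = 0 := by
  induction d with
  | zero =>
    intro A _ _ n X q hlie hgen hspan hnil hq hfin hadj hd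
    refine ⟨1, fun l hl hlen => ?_⟩
    obtain ⟨x, rfl⟩ := List.length_eq_one_iff.1 hlen
    have hx := hl x (by simp)
    by_cases h1 : q < 1
    · simpa [hq 1 h1] using hx
    · have : Module.finrank ℂ (n 1) = 0 := by
        have := Finset.sum_eq_zero_iff.1 (Nat.le_zero.1 hd) 1 (by simp; omega)
        exact this
      have h0 := Submodule.finrank_eq_zero.1 this
      simpa [h0] using hx
  | succ d ih =>
    intro A _ _ n X q hlie hgen hspan hnil hq hfin hadj hd
    by_cases h1 : n 1 = ⊥
    · refine ⟨1, fun l hl hlen => ?_⟩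
      obtain ⟨x, rfl⟩ := List.length_eq_one_iff.1 hlen
      simpa [h1] using hl x (by simp)
    -- the top nonzero degree
    obtain ⟨p, hp1, hpq, hpne, hptop⟩ : ∃ p, 1 ≤ p ∧ p ≤ q ∧ n p ≠ ⊥ ∧ ∀ j, p < j → n j = ⊥ := by
      classical
      have hne1 : 1 ≤ q := by
        by_contra h
        exact h1 (hq 1 (by omega))
      refine ⟨Nat.findGreatest (fun j => n j ≠ ⊥) q,
        Nat.le_findGreatest hne1 h1, Nat.findGreatest_le _,
        Nat.findGreatest_spec (P := fun j => n j ≠ ⊥) hne1 h1, ?_⟩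
      intro j hj
      by_contra h
      rcases le_or_gt j q with h' | h'
      · exact absurd (Nat.le_findGreatest (P := fun j => n j ≠ ⊥) h' h) (by omega)
      · exact h (hq j h')
    have hcomm : ∀ x ∈ n p, ∀ j, 1 ≤ j → ∀ y ∈ n j, Commute x y := by
      intro x hx j hj y hy
      have := hlie p j hp1 hj x hx y hy
      rw [hptop (p + j) (by omega)] at this
      exact sub_eq_zero.1 (by simpa using this)
    -- For `p > 1` the piece `n p` is spanned by commutators with nilpotent elements of `X`. They
    -- commute with both factors, `p` being the top degree, so they are nilpotent. For `p = 1` an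
    -- element of `X` serves.
    obtain ⟨z, hz, hz0, hznil⟩ : ∃ z ∈ n p, z ≠ 0 ∧ IsNilpotent z := by
      by_contra hcon
      push Not at hcon
      apply hpne
      rcases Nat.lt_or_ge 1 p with h | h
      · obtain ⟨j, rfl⟩ : ∃ j, p = j + 1 := ⟨p - 1, by omega⟩
        refine le_bot_iff.1 ((hgen j (by omega)).trans (Submodule.span_le.2 ?_))
        rintro _ ⟨v, hv, w, hw, rfl⟩
        have hv1 : v ∈ n 1 := hspan ▸ Submodule.subset_span hv
        have hmem := hlie j 1 (by omega) le_rfl w hw v hv1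
        by_contra hne
        exact hcon _ hmem hne (isNilpotent_commutator rfl (hcomm _ hmem 1 le_rfl _ hv1)
          (hcomm _ hmem j (by omega) _ hw) (hnil v hv))
      · obtain rfl : p = 1 := by omega
        rw [hspan]
        refine le_bot_iff.1 (Submodule.span_le.2 ?_)
        intro v hv
        by_contra hne
        exact hcon v (hspan ▸ Submodule.subset_span hv) hne (hnil v hv)
    have hzc : ∀ a, Commute z a := by
      intro a
      have ha : a ∈ Algebra.adjoin ℂ X := hadj ▸ Algebra.mem_top
      have hle : Algebra.adjoin ℂ X ≤ Subalgebra.centralizer ℂ {z} := by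
        refine Algebra.adjoin_le fun v hv => ?_
        rw [SetLike.mem_coe, Subalgebra.mem_centralizer_iff]
        intro y hy
        rw [Set.mem_singleton_iff.1 hy]
        exact hcomm z hz 1 le_rfl v (hspan ▸ Submodule.subset_span hv)
      exact (Subalgebra.mem_centralizer_iff ℂ).1 (hle ha) z rfl
    -- As `z` is central, `A z` is two-sided. Modulo it the piece `n p` loses the vector `z`, so the
    -- sum of dimensions drops and the induction hypothesis applies.
    let I : Ideal A := Ideal.span {z}
    have hI : ∀ a, a ∈ I ↔ ∃ b, a = b * z := by
      intro a
      rw [Ideal.mem_span_singleton']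
      exact ⟨fun ⟨b, hb⟩ => ⟨b, hb.symm⟩, fun ⟨b, hb⟩ => ⟨b, hb.symm⟩⟩
    have : I.IsTwoSided := ⟨fun {a} b ha => by
      obtain ⟨c, rfl⟩ := (hI a).1 ha
      exact (hI _).2 ⟨c * b, by rw [mul_assoc, (hzc b).eq, mul_assoc]⟩⟩
    let π : A →ₐ[ℂ] A ⧸ I := Ideal.Quotient.mkₐ ℂ I
    have hπz : π z = 0 := Ideal.Quotient.eq_zero_iff_mem.2 (Ideal.subset_span rfl)
    obtain ⟨K, hK⟩ := ih (A ⧸ I) (fun j => (n j).map π.toLinearMap) (π '' X) q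
      (by
        rintro j k hj hk _ ⟨x, hx, rfl⟩ _ ⟨y, hy, rfl⟩
        exact ⟨_, hlie j k hj hk x hx y hy, by simp⟩)
      (by
        intro j hj
        refine (Submodule.map_mono (hgen j hj)).trans ?_
        rw [Submodule.map_span]
        refine Submodule.span_mono ?_
        rintro _ ⟨_, ⟨v, hv, w, hw, rfl⟩, rfl⟩
        exact ⟨π v, ⟨v, hv, rfl⟩, π w, ⟨w, hw, rfl⟩, by simp⟩)
      (by rw [hspan, Submodule.map_span]; rfl)
      (by
        rintro _ ⟨v, hv, rfl⟩
        exact (hnil v hv).map π)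
      (by intro j hj; simp [hq j hj])
      (by intro j; infer_instance)
      (by
        rw [← AlgHom.map_adjoin, hadj, Algebra.map_top]
        exact (AlgHom.range_eq_top _).2 (Ideal.Quotient.mkₐ_surjective ℂ I))
      (by
        refine Nat.le_of_lt_succ (lt_of_lt_of_le ?_ hd)
        refine Finset.sum_lt_sum (fun j _ => Submodule.finrank_map_le _ _)
          ⟨p, Finset.mem_Icc.2 ⟨hp1, hpq⟩, ?_⟩
        have hrn := LinearMap.finrank_range_add_finrank_ker (π.toLinearMap.domRestrict (n p))
        rw [LinearMap.range_domRestrict] at hrn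
        have hpos : 0 < Module.finrank ℂ (LinearMap.ker (π.toLinearMap.domRestrict (n p))) := by
          refine Nat.pos_of_ne_zero fun h0 => ?_
          have h0' := Submodule.finrank_eq_zero.1 h0
          revert h0'
          rw [imp_false, ← ne_eq, Submodule.ne_bot_iff]
          exact ⟨⟨z, hz⟩, by simpa using hπz, by simpa using hz0⟩
        omega)
    obtain ⟨m, hm⟩ := hznil
    -- Products of length `K` lie in `A z`, so products of length `m * K` lie in `A z ^ m = 0`.
    refine ⟨m * K, fun l hl hlen => ?_⟩
    obtain ⟨a, ha⟩ := list_prod_eq_mul_pow (S := n 1) hzc (K := K) (fun l hl hlen => by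
      refine (hI _).1 (Ideal.Quotient.eq_zero_iff_mem.1 ?_)
      have := hK (l.map π) (by
        intro x hx
        obtain ⟨y, hy, rfl⟩ := List.mem_map.1 hx
        exact ⟨y, hl y hy, rfl⟩) (by simpa using hlen)
      rw [← map_list_prod] at this
      exact this) m l hl hlen
    rw [ha, hm, mul_zero]

/-- Reduces to the case where `X` generates the algebra: the subalgebra generated by `X` contains
every `n j` with `j ≥ 1`, and by bilinearity commutators with `n 1` reduce to commutators with `X`.
-/
theorem exists_list_prod_eq_zero_of_graded {A : Type u} [Ring A] [Algebra ℂ A]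
    (n : ℕ → Submodule ℂ A) (X : Set A) (q : ℕ)
    (hlie : ∀ j k, 1 ≤ j → 1 ≤ k → ∀ x ∈ n j, ∀ y ∈ n k, x * y - y * x ∈ n (j + k))
    (hgen : ∀ j, 1 ≤ j → n (j + 1) ≤
      Submodule.span ℂ {a | ∃ v ∈ n 1, ∃ w ∈ n j, a = v * w - w * v})
    (hspan : n 1 = Submodule.span ℂ X) (hnil : ∀ v ∈ X, IsNilpotent v)
    (hq : ∀ j, q < j → n j = ⊥) (hfin : ∀ j, Module.Finite ℂ (n j)) :
    ∃ K, ∀ l : List A, (∀ x ∈ l, x ∈ n 1) → l.length = K → l.prod = 0 := by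
  have hgen' : ∀ j, 1 ≤ j → n (j + 1) ≤
      Submodule.span ℂ {a | ∃ v ∈ X, ∃ w ∈ n j, a = w * v - v * w} := by
    intro j hj
    refine (hgen j hj).trans (Submodule.span_le.2 ?_)
    rintro _ ⟨v, hv, w, hw, rfl⟩
    rw [hspan] at hv
    rw [SetLike.mem_coe, ← Submodule.neg_mem_iff, neg_sub]
    induction hv using Submodule.span_induction with
    | mem v hv => exact Submodule.subset_span ⟨v, hv, w, hw, rfl⟩
    | zero => simp
    | add v v' _ _ h h' =>
      convert Submodule.add_mem _ h h' using 1
      noncomm_ring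
    | smul c v _ h =>
      convert Submodule.smul_mem _ c h using 1
      rw [mul_smul_comm, smul_mul_assoc, smul_sub]
  set B := Algebra.adjoin ℂ X with hB
  have hXB : X ⊆ B := Algebra.subset_adjoin
  have hnB : ∀ j, n (j + 1) ≤ Subalgebra.toSubmodule B := by
    intro j
    induction j with
    | zero =>
      rw [zero_add, hspan]
      exact Submodule.span_le.2 hXB
    | succ j ih =>
      refine (hgen' (j + 1) (by omega)).trans (Submodule.span_le.2 ?_)
      rintro _ ⟨v, hv, w, hw, rfl⟩
      exact B.sub_mem (B.mul_mem (ih hw) (hXB hv)) (B.mul_mem (hXB hv) (ih hw))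
  have hmap : ∀ j, 1 ≤ j → ((n j).comap B.val.toLinearMap).map B.val.toLinearMap = n j := by
    intro j hj
    obtain ⟨j, rfl⟩ : ∃ i, j = i + 1 := ⟨j - 1, by omega⟩
    rw [Submodule.map_comap_eq, inf_eq_right]
    intro x hx
    exact ⟨⟨x, hnB j hx⟩, rfl⟩
  have hinj : Function.Injective (Submodule.map B.val.toLinearMap) :=
    Submodule.map_injective_of_injective Subtype.val_injective
  have himg : B.val '' (B.val ⁻¹' X) = X := by
    rw [Set.image_preimage_eq_iff]
    intro x hx
    exact ⟨⟨x, hXB hx⟩, rfl⟩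
  obtain ⟨K, hK⟩ := exists_list_prod_eq_zero _ B (fun j => (n j).comap B.val.toLinearMap)
    (B.val ⁻¹' X) q
    (fun j k hj hk x hx y hy => hlie j k hj hk _ hx _ hy)
    (by
      intro j hj
      rw [← Submodule.map_le_map_iff_of_injective (f := B.val.toLinearMap)
        Subtype.val_injective, hmap (j + 1) (by omega), Submodule.map_span]
      refine (hgen' j hj).trans (Submodule.span_mono ?_)
      rintro _ ⟨v, hv, w, hw, rfl⟩
      rw [← hmap j hj] at hw
      obtain ⟨w, hw, rfl⟩ := hw
      exact ⟨w * ⟨v, hXB hv⟩ - ⟨v, hXB hv⟩ * w, ⟨⟨v, hXB hv⟩, hv, w, hw, rfl⟩, rfl⟩)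
    (by
      apply hinj
      rw [hmap 1 le_rfl, Submodule.map_span, hspan]
      exact congrArg _ himg.symm)
    (by
      intro v hv
      exact (IsNilpotent.map_iff (f := B.val) Subtype.val_injective).1 (hnil _ hv))
    (by
      intro j hj
      rw [hq j hj]
      exact LinearMap.ker_eq_bot.2 Subtype.val_injective)
    (by
      intro j
      have := hfin j
      exact Module.Finite.of_injective
        (B.val.toLinearMap.restrict (p := (n j).comap B.val.toLinearMap) (q := n j) fun x hx => hx)
        (fun x y h => by
          have h' := congrArg Subtype.val h
          exact Subtype.ext (Subtype.ext h')))
    (by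
      refine Subalgebra.map_injective (f := B.val) Subtype.val_injective ?_
      rw [AlgHom.map_adjoin, himg, Algebra.map_top, Subalgebra.range_val])
    le_rfl
  refine ⟨K, fun l hl hlen => ?_⟩
  have hlB : ∀ x ∈ l, x ∈ B := fun x hx => hnB 0 (hl x hx)
  have h := hK (l.attach.map fun x => ⟨x.1, hlB x.1 x.2⟩) (by
    intro x hx
    obtain ⟨y, -, rfl⟩ := List.mem_map.1 hx
    exact hl y.1 y.2) (by simpa using hlen)
  have h2 := congrArg B.val h
  rw [map_list_prod, List.map_map, map_zero] at h2
  simpa [Function.comp_def] using h2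

end NilpotentGeneration

/-! ### The two filtrations attached to a pair M ≤ E -/

section Filtrations

variable {L : Type u} [LieRing L] [LieAlgebra ℂ L]

/-- The decreasing filtration `M = H 0 ≥ H 1 ≥ …` with `H (n + 1) = {x ∈ H n | [E, x] ⊆ H n}`. -/
def lowerFiltration (M E : Submodule ℂ L) : ℕ → Submodule ℂ L
  | 0 => M
  | n + 1 => lowerFiltration M E n ⊓ ⨅ e : E, (lowerFiltration M E n).comap (LieAlgebra.ad ℂ L e)

/-- The increasing filtration `M ≤ E ≤ E + [E, E] ≤ …`. -/
def upperFiltration (M E : Submodule ℂ L) : ℕ → Submodule ℂ L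
  | 0 => M
  | 1 => E
  | n + 2 => upperFiltration M E (n + 1) ⊔
      Submodule.span ℂ {a | ∃ e ∈ E, ∃ z ∈ upperFiltration M E (n + 1), a = ⁅e, z⁆}

variable {M E : Submodule ℂ L}

theorem mem_lowerFiltration_succ {n : ℕ} {x : L} : x ∈ lowerFiltration M E (n + 1) ↔
    x ∈ lowerFiltration M E n ∧ ∀ e ∈ E, ⁅e, x⁆ ∈ lowerFiltration M E n := by
  simp [lowerFiltration]

theorem lowerFiltration_antitone : Antitone (lowerFiltration M E) :=
  antitone_nat_of_succ_le fun _ _ hx => (mem_lowerFiltration_succ.1 hx).1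

theorem lie_mem_lowerFiltration {n : ℕ} {e x : L} (he : e ∈ E)
    (hx : x ∈ lowerFiltration M E (n + 1)) : ⁅e, x⁆ ∈ lowerFiltration M E n :=
  (mem_lowerFiltration_succ.1 hx).2 e he

theorem lie_mem_lowerFiltration_of_mem (hM : ∀ m ∈ M, ∀ x ∈ M, ⁅m, x⁆ ∈ M)
    (hE : ∀ m ∈ M, ∀ x ∈ E, ⁅m, x⁆ ∈ E) (n : ℕ) {m x : L} (hm : m ∈ M)
    (hx : x ∈ lowerFiltration M E n) : ⁅m, x⁆ ∈ lowerFiltration M E n := by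
  induction n generalizing x with
  | zero => exact hM m hm x hx
  | succ n ih =>
    refine mem_lowerFiltration_succ.2 ⟨ih (mem_lowerFiltration_succ.1 hx).1, fun e he => ?_⟩
    rw [leibniz_lie]
    refine add_mem (lie_mem_lowerFiltration ?_ hx) (ih (lie_mem_lowerFiltration he hx))
    rw [← lie_skew]
    exact neg_mem (hE m hm e he)

theorem upperFiltration_monotone (hME : M ≤ E) : Monotone (upperFiltration M E) := by
  refine monotone_nat_of_le_succ fun n => ?_
  match n with
  | 0 => exact hME
  | n + 1 => exact le_sup_left

theorem lie_mem_upperFiltration_succ {n : ℕ} {e z : L} (he : e ∈ E)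
    (hz : z ∈ upperFiltration M E (n + 1)) : ⁅e, z⁆ ∈ upperFiltration M E (n + 2) :=
  Submodule.mem_sup_right (Submodule.subset_span ⟨e, he, z, hz, rfl⟩)

@[elab_as_elim]
theorem upperFiltration_induction {p : L → Prop} {n : ℕ} (hadd : ∀ x y, p x → p y → p (x + y))
    (hsmul : ∀ (c : ℂ) x, p x → p (c • x)) (hold : ∀ z ∈ upperFiltration M E (n + 1), p z)
    (hlie : ∀ e ∈ E, ∀ z ∈ upperFiltration M E (n + 1), p ⁅e, z⁆) {z : L}
    (hz : z ∈ upperFiltration M E (n + 2)) : p z := by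
  obtain ⟨x, hx, y, hy, rfl⟩ := Submodule.mem_sup.1 hz
  refine hadd _ _ (hold x hx) ?_
  clear hz
  induction hy using Submodule.span_induction with
  | mem y hy =>
    obtain ⟨e, he, z, hz, rfl⟩ := hy
    exact hlie e he z hz
  | zero => exact hold 0 (zero_mem _)
  | add x y _ _ hx' hy' => exact hadd _ _ hx' hy'
  | smul c x _ hx' => exact hsmul _ _ hx'

/-- Step `j` of the increasing filtration acts with degree `-j` on the decreasing one. Induction on
`j` through [[e, z], x] = [e, [z, x]] - [z, [e, x]]. -/
theorem lie_upperFiltration_mem_lowerFiltration (hM : ∀ m ∈ M, ∀ x ∈ M, ⁅m, x⁆ ∈ M)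
    (hE : ∀ m ∈ M, ∀ x ∈ E, ⁅m, x⁆ ∈ E) (j : ℕ) : ∀ {z : L}, z ∈ upperFiltration M E j →
    ∀ {i : ℕ} {x : L}, x ∈ lowerFiltration M E (i + j) → ⁅z, x⁆ ∈ lowerFiltration M E i := by
  induction j using Nat.twoStepInduction with
  | zero =>
    intro z hz i x hx
    exact lie_mem_lowerFiltration_of_mem hM hE i hz hx
  | one =>
    intro z hz i x hx
    exact lie_mem_lowerFiltration hz hx
  | more j _ ih =>
    intro z hz
    refine upperFiltration_induction (p := fun z => ∀ {i : ℕ} {x : L},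
      x ∈ lowerFiltration M E (i + (j + 2)) → ⁅z, x⁆ ∈ lowerFiltration M E i) ?_ ?_ ?_ ?_ hz
    · intro y z hy hz i x hx
      rw [add_lie]
      exact add_mem (hy hx) (hz hx)
    · intro c y hy i x hx
      rw [smul_lie]
      exact Submodule.smul_mem _ _ (hy hx)
    · intro z hz i x hx
      exact ih hz (lowerFiltration_antitone (by omega) hx)
    · intro e he z hz i x hx
      rw [lie_lie]
      refine sub_mem (lie_mem_lowerFiltration he (ih hz (i := i + 1) ?_)) (ih hz ?_)
      · rwa [show i + 1 + (j + 1) = i + (j + 2) by omega]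
      · exact lie_mem_lowerFiltration he hx

theorem lie_mem_upperFiltration (hME : M ≤ E) (j : ℕ) : ∀ {x : L},
    x ∈ upperFiltration M E (j + 1) → ∀ {k : ℕ} {z : L}, z ∈ upperFiltration M E (k + 1) →
    ⁅x, z⁆ ∈ upperFiltration M E (j + k + 2) := by
  induction j with
  | zero =>
    intro x hx k z hz
    rw [zero_add]
    exact lie_mem_upperFiltration_succ hx hz
  | succ j ih =>
    intro x hx
    refine upperFiltration_induction (p := fun x => ∀ {k : ℕ} {z : L},
      z ∈ upperFiltration M E (k + 1) → ⁅x, z⁆ ∈ upperFiltration M E (j + 1 + k + 2)) ?_ ?_ ?_ ?_ hx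
    · intro y z hy hz i x hx
      rw [add_lie]
      exact add_mem (hy hx) (hz hx)
    · intro c y hy i x hx
      rw [smul_lie]
      exact Submodule.smul_mem _ _ (hy hx)
    · intro x hx k z hz
      exact upperFiltration_monotone hME (by omega) (ih hx hz)
    · intro e he x hx k z hz
      rw [lie_lie]
      refine sub_mem ?_ ?_
      · rw [show j + 1 + k + 2 = j + k + 1 + 2 by omega]
        exact lie_mem_upperFiltration_succ he (ih hx hz)
      · have := ih hx (lie_mem_upperFiltration_succ he hz)
        rwa [show j + (k + 1) + 2 = j + 1 + k + 2 by omega] at this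

/-- If `M` is maximal among the subalgebras containing it, the increasing filtration is
exhaustive. -/
theorem exists_upperFiltration_eq_top (hME : M < E) [Module.Finite ℂ (L ⧸ M)]
    (hmax : ∀ T : LieSubalgebra ℂ L, M < T.toSubmodule → T = ⊤) :
    ∃ q, upperFiltration M E (q + 1) = ⊤ := by
  have hle : ∀ j, M ≤ upperFiltration M E (j + 1) := fun j =>
    upperFiltration_monotone hME.le (Nat.zero_le _)
  let f : ℕ →o Submodule ℂ (L ⧸ M) :=
    ⟨fun j => (upperFiltration M E (j + 1)).map M.mkQ, fun i j h =>
      Submodule.map_mono (upperFiltration_monotone hME.le (by omega))⟩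
  obtain ⟨q, hq⟩ := monotone_stabilizes_iff_noetherian.2 inferInstance f
  have hq' : ∀ m, q ≤ m → upperFiltration M E (m + 1) = upperFiltration M E (q + 1) := by
    intro m hm
    have h : (upperFiltration M E (q + 1)).map M.mkQ = (upperFiltration M E (m + 1)).map M.mkQ :=
      hq m hm
    have h' := congrArg (Submodule.comap M.mkQ) h
    rwa [Submodule.comap_map_mkQ, Submodule.comap_map_mkQ, sup_eq_right.2 (hle _),
      sup_eq_right.2 (hle _), eq_comm] at h'
  -- The steps contain `M`, so they stabilize because L/M is finite-dimensional. Brackets add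
  -- degrees, so the stable step is a subalgebra strictly above `M`.
  let T : LieSubalgebra ℂ L :=
    { upperFiltration M E (q + 1) with
      lie_mem' := by
        intro x y hx hy
        have := lie_mem_upperFiltration hME.le q hx hy
        rwa [show q + q + 2 = (q + q + 1) + 1 by omega, hq' _ (by omega)] at this }
  have hT : M < T.toSubmodule :=
    hME.trans_le (upperFiltration_monotone hME.le (by omega : 1 ≤ q + 1))
  have := hmax T hT
  exact ⟨q, congrArg LieSubalgebra.toSubmodule this⟩

/-- Since `M` preserves each step, the condition defining the next one need only be tested on
finitely many vectors spanning `E` modulo `M`, and each test cuts out a subspace of finite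
codimension. -/
theorem finite_quotient_lowerFiltration (hM : ∀ m ∈ M, ∀ x ∈ M, ⁅m, x⁆ ∈ M)
    (hE : ∀ m ∈ M, ∀ x ∈ E, ⁅m, x⁆ ∈ E) (hME : M ≤ E) [Module.Finite ℂ (L ⧸ M)] (n : ℕ) :
    (lowerFiltration M E n).CoFG := by
  induction n with
  | zero => assumption
  | succ n ih =>
    obtain ⟨C, hC⟩ := M.exists_isCompl
    have : Module.Finite ℂ C := .of_fg (Submodule.CoFG.fg_of_isCompl hC inferInstance)
    have hfg : (C ⊓ E).FG :=
      (Submodule.fg_iff_finiteDimensional _).2 (Submodule.finiteDimensional_of_le inf_le_left)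
    obtain ⟨s, hs⟩ := hfg
    have hsE : ∀ e ∈ s, e ∈ E := fun e he => (hs ▸ Submodule.subset_span he : e ∈ C ⊓ E).2
    have hfin : (sInf ((fun e => (lowerFiltration M E n).comap (LieAlgebra.ad ℂ L e)) ''
        (s : Set L))).CoFG := by
      refine Submodule.CoFG.sInf_of_finite (s.finite_toSet.image _) ?_
      rintro _ ⟨e, -, rfl⟩
      have := Submodule.CoFG.ker ((lowerFiltration M E n).mkQ ∘ₗ
        (LieAlgebra.ad ℂ L e : L →ₗ[ℂ] L))
      rwa [LinearMap.ker_comp, Submodule.ker_mkQ] at this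
    refine (ih.inf hfin).of_le ?_
    rintro x ⟨hx, hx'⟩
    refine mem_lowerFiltration_succ.2 ⟨hx, fun e he => ?_⟩
    have he' : e ∈ M ⊔ Submodule.span ℂ (s : Set L) := by
      rw [hs, ← sup_inf_assoc_of_le C hME, hC.sup_eq_top, top_inf_eq]
      exact he
    obtain ⟨m, hm, c, hc, rfl⟩ := Submodule.mem_sup.1 he'
    rw [add_lie]
    refine add_mem (lie_mem_lowerFiltration_of_mem hM hE n hm hx) ?_
    clear he he'
    induction hc using Submodule.span_induction with
    | mem c hc => exact (Submodule.mem_sInf.1 hx') _ ⟨c, hc, rfl⟩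
    | zero => simp
    | add c d _ _ h h' => rw [add_lie]; exact add_mem h h'
    | smul a c _ h => rw [smul_lie]; exact Submodule.smul_mem _ _ h

end Filtrations

/-! ### The action on the graded pieces of the decreasing filtration -/

section GradedAction

variable {L : Type u} [LieRing L] [LieAlgebra ℂ L]

/-- The operator on sequences that shifts by `j` and applies `ad y`. -/
def shiftAd (j : ℕ) : L →ₗ[ℂ] Module.End ℂ (ℕ → L) :=
  LinearMap.mk₂ ℂ (fun y s i => ⁅y, s (i + j)⁆) (by intros; ext; simp) (by intros; ext; simp)
    (by intros; ext; simp) (by intros; ext; simp)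

@[simp]
theorem shiftAd_apply (j : ℕ) (y : L) (s : ℕ → L) (i : ℕ) : shiftAd j y s i = ⁅y, s (i + j)⁆ := rfl

variable (M E : Submodule ℂ L)

/-- The sequences whose `i`-th term lies in the `i + r`-th step of the decreasing filtration. -/
def filtrationSections (r : ℕ) : Submodule ℂ (ℕ → L) where
  carrier := {s | ∀ i, s i ∈ lowerFiltration M E (i + r)}
  add_mem' hs ht i := add_mem (hs i) (ht i)
  zero_mem' _ := zero_mem _
  smul_mem' c _ hs i := Submodule.smul_mem _ c (hs i)

/-- The product of the graded pieces of the decreasing filtration. -/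
abbrev GradedProduct : Type u :=
  filtrationSections M E 0 ⧸ (filtrationSections M E 1).comap (filtrationSections M E 0).subtype

variable {M E}

theorem shiftAd_mem (hM : ∀ m ∈ M, ∀ x ∈ M, ⁅m, x⁆ ∈ M) (hE : ∀ m ∈ M, ∀ x ∈ E, ⁅m, x⁆ ∈ E)
    {j r : ℕ} {y : L} (hy : y ∈ upperFiltration M E j) {s : ℕ → L}
    (hs : s ∈ filtrationSections M E r) : shiftAd j y s ∈ filtrationSections M E r := by
  intro i
  refine lie_upperFiltration_mem_lowerFiltration hM hE j hy ?_
  rw [add_right_comm]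
  exact hs (i + j)

/-- The action of the `j`-th step of the increasing filtration on the graded pieces. -/
def gradedAction (hM : ∀ m ∈ M, ∀ x ∈ M, ⁅m, x⁆ ∈ M) (hE : ∀ m ∈ M, ∀ x ∈ E, ⁅m, x⁆ ∈ E)
    (j : ℕ) :
    upperFiltration M E j →ₗ[ℂ] Module.End ℂ (GradedProduct M E) where
  toFun y := Submodule.mapQ _ _
    ((shiftAd j y.1).restrict (p := filtrationSections M E 0) (q := filtrationSections M E 0)
      fun _ hs => shiftAd_mem hM hE y.2 hs)
    fun _ hs => shiftAd_mem hM hE y.2 hs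
  map_add' y z := by
    refine Submodule.linearMap_qext _ (LinearMap.ext fun s => ?_)
    refine congrArg (Submodule.Quotient.mk) (Subtype.ext (funext fun i => ?_))
    exact add_lie _ _ _
  map_smul' c y := by
    refine Submodule.linearMap_qext _ (LinearMap.ext fun s => ?_)
    refine congrArg (Submodule.Quotient.mk) (Subtype.ext (funext fun i => ?_))
    exact smul_lie _ _ _

variable (hM : ∀ m ∈ M, ∀ x ∈ M, ⁅m, x⁆ ∈ M) (hE : ∀ m ∈ M, ∀ x ∈ E, ⁅m, x⁆ ∈ E)

theorem gradedAction_mk (j : ℕ) (y : upperFiltration M E j) (s : filtrationSections M E 0) :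
    gradedAction hM hE j y (Submodule.Quotient.mk s) =
      Submodule.Quotient.mk ⟨shiftAd j y.1 s.1, shiftAd_mem hM hE y.2 s.2⟩ := rfl

/-- An element of a lower step `i` costs only `i` degrees while the sequence is shifted by `j`, so
the result lies one step deeper. Hence the action sees only the graded quotients of the increasing
filtration. -/
theorem gradedAction_eq_zero {i j : ℕ} (hij : i < j) (y : upperFiltration M E j)
    (hy : y.1 ∈ upperFiltration M E i) : gradedAction hM hE j y = 0 := by
  refine Submodule.linearMap_qext _ (LinearMap.ext fun s => ?_)
  refine (Submodule.Quotient.mk_eq_zero _).2 fun n => ?_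
  refine lie_upperFiltration_mem_lowerFiltration hM hE i hy ?_
  exact lowerFiltration_antitone (by omega) (s.2 (n + j))

theorem gradedAction_commutator {j k : ℕ} (y : upperFiltration M E j) (z : upperFiltration M E k)
    (h : ⁅y.1, z.1⁆ ∈ upperFiltration M E (j + k)) :
    gradedAction hM hE j y * gradedAction hM hE k z -
      gradedAction hM hE k z * gradedAction hM hE j y = gradedAction hM hE (j + k) ⟨_, h⟩ := by
  refine Submodule.linearMap_qext _ (LinearMap.ext fun s => ?_)
  refine congrArg (Submodule.Quotient.mk) (Subtype.ext (funext fun i => ?_))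
  change ⁅y.1, ⁅z.1, s.1 (i + j + k)⁆⁆ - ⁅z.1, ⁅y.1, s.1 (i + k + j)⁆⁆ =
    ⁅⁅y.1, z.1⁆, s.1 (i + (j + k))⁆
  rw [lie_lie, add_right_comm i k j, add_assoc]

/-- An explicit representative translates products of operators on the quotient into iterated
brackets in `L`. -/
theorem list_prod_gradedAction (l : List (upperFiltration M E 1)) (s : filtrationSections M E 0) :
    ∃ s' : filtrationSections M E 0,
      (∀ i, s'.1 i = l.foldr (fun e x => ⁅e.1, x⁆) (s.1 (i + l.length))) ∧
      (l.map (gradedAction hM hE 1)).prod (Submodule.Quotient.mk s) = Submodule.Quotient.mk s' := by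
  induction l with
  | nil => exact ⟨s, by simp, rfl⟩
  | cons e l ih =>
    obtain ⟨s', hs', h⟩ := ih
    refine ⟨⟨shiftAd 1 e.1 s'.1, shiftAd_mem hM hE e.2 s'.2⟩, ?_, ?_⟩
    · intro i
      simp [hs', add_assoc, add_comm 1]
    · rw [List.map_cons, List.prod_cons]
      exact (congrArg (gradedAction hM hE 1 e) h).trans (gradedAction_mk hM hE 1 e s')

theorem foldr_replicate {α β : Type*} (f : α → β → β) (a : α) (b : β) (k : ℕ) :
    (List.replicate k a).foldr f b = (f a)^[k] b := by
  induction k with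
  | zero => rfl
  | succ k ih => rw [List.replicate_succ, List.foldr_cons, ih, Function.iterate_succ_apply']

theorem gradedAction_mem_of_mem_span {j : ℕ} {S : Set L}
    (W : Submodule ℂ (Module.End ℂ (GradedProduct M E)))
    (hS : ∀ y ∈ S, ∃ h : y ∈ upperFiltration M E j, gradedAction hM hE j ⟨y, h⟩ ∈ W)
    {y : upperFiltration M E j} (hy : y.1 ∈ Submodule.span ℂ S) : gradedAction hM hE j y ∈ W := by
  have hmem : y.1 ∈ (W.comap (gradedAction hM hE j)).map (upperFiltration M E j).subtype := by
    refine Submodule.span_le.2 ?_ hy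
    intro z hz
    obtain ⟨h, hW⟩ := hS z hz
    exact ⟨⟨z, h⟩, hW, rfl⟩
  obtain ⟨z, hz, hzy⟩ := hmem
  rwa [← Subtype.ext hzy]

theorem isNilpotent_gradedAction {k : ℕ} (v : upperFiltration M E 1)
    (hv : ∀ i, ∀ x ∈ lowerFiltration M E (i + k),
      (fun x => ⁅v.1, x⁆)^[k] x ∈ lowerFiltration M E (i + 1)) :
    IsNilpotent (gradedAction hM hE 1 v) := by
  refine ⟨k, LinearMap.ext fun t => ?_⟩
  obtain ⟨s, rfl⟩ := Submodule.Quotient.mk_surjective _ t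
  obtain ⟨s', hs', h⟩ := list_prod_gradedAction hM hE (List.replicate k v) s
  rw [List.map_replicate, List.prod_replicate] at h
  rw [h, LinearMap.zero_apply, Submodule.Quotient.mk_eq_zero]
  intro i
  change s'.1 i ∈ _
  rw [hs', foldr_replicate, List.length_replicate]
  exact hv i _ (s.2 (i + k))

/-- In positive degree `M` acts by zero, so the action factors through a subspace of L/M. The
argument says nothing about degree 0. -/
theorem finite_range_gradedAction [Module.Finite ℂ (L ⧸ M)] (j : ℕ) :
    Module.Finite ℂ (LinearMap.range (gradedAction hM hE (j + 1))) := by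
  refine .of_fg (Submodule.range_fg_iff_ker_cofg.2 ?_)
  refine (Submodule.CoFG.ker (M.mkQ ∘ₗ (upperFiltration M E (j + 1)).subtype)).of_le ?_
  intro y hy
  rw [LinearMap.mem_ker, LinearMap.comp_apply, ← LinearMap.mem_ker, Submodule.ker_mkQ] at hy
  exact gradedAction_eq_zero hM hE (Nat.succ_pos j) y hy

theorem gradedAction_commutator_mem_range (hME : M ≤ E) {j k : ℕ}
    (y : upperFiltration M E (j + 1)) (z : upperFiltration M E (k + 1)) :
    gradedAction hM hE (j + 1) y * gradedAction hM hE (k + 1) z -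
      gradedAction hM hE (k + 1) z * gradedAction hM hE (j + 1) y ∈
        LinearMap.range (gradedAction hM hE (j + k + 1 + 1)) := by
  have hyz := lie_mem_upperFiltration hME j y.2 z.2
  have hjk : j + 1 + (k + 1) = j + k + 1 + 1 := by omega
  have hyz' : ⁅y.1, z.1⁆ ∈ upperFiltration M E (j + 1 + (k + 1)) := by rwa [hjk]
  rw [gradedAction_commutator hM hE y z hyz', ← hjk]
  exact LinearMap.mem_range_self _ _

/-- Modulo the previous step, which acts by zero here, step `j + 2` consists of sums of brackets of
`E` with step `j + 1`, and these act by commutators. -/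
theorem range_gradedAction_le (hME : M ≤ E) (j : ℕ) :
    LinearMap.range (gradedAction hM hE (j + 2)) ≤
      Submodule.span ℂ {a | ∃ v ∈ LinearMap.range (gradedAction hM hE 1),
        ∃ w ∈ LinearMap.range (gradedAction hM hE (j + 1)), a = v * w - w * v} := by
  rintro _ ⟨⟨y, hy⟩, rfl⟩
  obtain ⟨y₁, hy₁, y₂, hy₂, rfl⟩ := Submodule.mem_sup.1 hy
  have hy₁' : y₁ ∈ upperFiltration M E (j + 2) := upperFiltration_monotone hME (by omega) hy₁
  have hy₂' : y₂ ∈ upperFiltration M E (j + 2) := Submodule.mem_sup_right hy₂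
  have : (⟨y₁ + y₂, hy⟩ : upperFiltration M E (j + 2)) = ⟨y₁, hy₁'⟩ + ⟨y₂, hy₂'⟩ := rfl
  rw [this, map_add, gradedAction_eq_zero hM hE (by omega : j + 1 < j + 2) ⟨y₁, hy₁'⟩ hy₁, zero_add]
  refine gradedAction_mem_of_mem_span hM hE _ ?_ hy₂
  rintro _ ⟨e, he, z, hz, rfl⟩
  refine ⟨lie_mem_upperFiltration_succ he hz, Submodule.subset_span ?_⟩
  have key : ∀ i (hi : i = j + 2) (h : ⁅e, z⁆ ∈ upperFiltration M E i)
      (h' : ⁅e, z⁆ ∈ upperFiltration M E (j + 2)),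
      gradedAction hM hE i ⟨_, h⟩ = gradedAction hM hE (j + 2) ⟨_, h'⟩ := by
    rintro _ rfl _ _
    rfl
  have hez : ⁅e, z⁆ ∈ upperFiltration M E (1 + (j + 1)) := by
    rw [add_comm]
    exact lie_mem_upperFiltration_succ he hz
  refine ⟨gradedAction hM hE 1 ⟨e, he⟩, LinearMap.mem_range_self _ _,
    gradedAction hM hE (j + 1) ⟨z, hz⟩, LinearMap.mem_range_self _ _, ?_⟩
  rw [gradedAction_commutator hM hE (j := 1) ⟨e, he⟩ ⟨z, hz⟩ hez]
  exact (key _ (by omega) _ _).symm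

theorem range_gradedAction_one (hME : M ≤ E) {N : Set L} (hNE : N ⊆ E)
    (hspan : E ≤ M ⊔ Submodule.span ℂ N) :
    LinearMap.range (gradedAction hM hE 1) =
      Submodule.span ℂ (gradedAction hM hE 1 '' {v | v.1 ∈ N}) := by
  refine le_antisymm ?_ (Submodule.span_le.2 ?_)
  · rintro _ ⟨⟨y, hy⟩, rfl⟩
    obtain ⟨m, hm, y₂, hy₂, rfl⟩ := Submodule.mem_sup.1 (hspan hy)
    have hm' : m ∈ upperFiltration M E 1 := hME hm
    have hy₂' : y₂ ∈ upperFiltration M E 1 := Submodule.span_le.2 hNE hy₂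
    have : (⟨m + y₂, hy⟩ : upperFiltration M E 1) = ⟨m, hm'⟩ + ⟨y₂, hy₂'⟩ := rfl
    rw [this, map_add, gradedAction_eq_zero hM hE (by omega : 0 < 1) ⟨m, hm'⟩ hm, zero_add]
    refine gradedAction_mem_of_mem_span hM hE _ ?_ hy₂
    intro y hy
    exact ⟨hNE hy, Submodule.subset_span ⟨⟨y, hNE hy⟩, hy, rfl⟩⟩
  · rintro _ ⟨v, -, rfl⟩
    exact LinearMap.mem_range_self _ _

include hM hE in
/-- If `E` is spanned modulo `M` by elements acting nilpotently on the graded pieces, then long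
products of elements of `E` act trivially on the graded pieces. -/
theorem exists_foldr_lie_mem (hME : M ≤ E) [Module.Finite ℂ (L ⧸ M)] {q : ℕ}
    (hq : upperFiltration M E (q + 1) = ⊤) {N : Set L} {k : ℕ} (hNE : N ⊆ E)
    (hN : ∀ y ∈ N, ∀ i, ∀ x ∈ lowerFiltration M E (i + k),
      (fun x => ⁅y, x⁆)^[k] x ∈ lowerFiltration M E (i + 1))
    (hspan : E ≤ M ⊔ Submodule.span ℂ N) :
    ∃ K, ∀ l : List L, (∀ e ∈ l, e ∈ E) → l.length = K → ∀ x ∈ lowerFiltration M E K,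
      l.foldr (fun e x => ⁅e, x⁆) x ∈ lowerFiltration M E 1 := by
  -- Degree 0 is replaced by `⊥` to have all pieces finite-dimensional; the bracket conditions
  -- concern only degrees `≥ 1`.
  let n : ℕ → Submodule ℂ (Module.End ℂ (GradedProduct M E)) := fun j =>
    Nat.casesOn j ⊥ fun j => LinearMap.range (gradedAction hM hE (j + 1))
  have hn : ∀ j, n (j + 1) = LinearMap.range (gradedAction hM hE (j + 1)) := fun _ => rfl
  obtain ⟨K, hK⟩ := exists_list_prod_eq_zero_of_graded n (gradedAction hM hE 1 '' {v | v.1 ∈ N})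
    (q + 1)
    (by
      intro j k hj hk
      obtain ⟨j, rfl⟩ : ∃ i, j = i + 1 := ⟨j - 1, by omega⟩
      obtain ⟨k, rfl⟩ : ∃ i, k = i + 1 := ⟨k - 1, by omega⟩
      rw [show j + 1 + (k + 1) = j + k + 1 + 1 by omega, hn, hn, hn]
      rintro _ ⟨y, rfl⟩ _ ⟨z, rfl⟩
      exact gradedAction_commutator_mem_range hM hE hME y z)
    (by
      intro j hj
      obtain ⟨j, rfl⟩ : ∃ i, j = i + 1 := ⟨j - 1, by omega⟩
      exact range_gradedAction_le hM hE hME j)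
    (range_gradedAction_one hM hE hME hNE hspan)
    (by
      rintro _ ⟨v, hv, rfl⟩
      exact isNilpotent_gradedAction hM hE v (hN v.1 hv))
    (by
      intro j hj
      obtain ⟨j, rfl⟩ : ∃ i, j = i + 1 := ⟨j - 1, by omega⟩
      refine LinearMap.range_eq_bot.2 (LinearMap.ext fun y => ?_)
      exact gradedAction_eq_zero hM hE hj y (by rw [hq]; trivial))
    (by
      intro j
      cases j with
      | zero => exact Module.Finite.bot ℂ _
      | succ j => exact finite_range_gradedAction hM hE j)
  refine ⟨K, fun l hl hlen x hx => ?_⟩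
  -- The sequence with the single entry `x` at index `K`: a product of `K` operators of degree one
  -- moves that entry to index 0, where the vanishing of the product is read off.
  have hs : Pi.single K x ∈ filtrationSections M E 0 := by
    intro i
    rcases eq_or_ne i K with rfl | h
    · simpa using hx
    · simp [h]
  let l' : List (upperFiltration M E 1) := l.attach.map fun e => ⟨e.1, hl e.1 e.2⟩
  obtain ⟨s', hs', h⟩ := list_prod_gradedAction hM hE l' ⟨Pi.single K x, hs⟩
  rw [hK _ (by
    intro a ha
    obtain ⟨e, -, rfl⟩ := List.mem_map.1 ha
    exact LinearMap.mem_range_self _ _) (by simpa [l'] using hlen), LinearMap.zero_apply] at h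
  have h0 : s'.1 0 ∈ lowerFiltration M E 1 := (Submodule.Quotient.mk_eq_zero _).1 h.symm 0
  rw [hs'] at h0
  simpa [l', List.foldr_map, hlen] using h0

end GradedAction

/-! ### A norm estimate modulo a closed subspace -/

section QuotientNorm

variable {E : Type*} [NormedAddCommGroup E] [NormedSpace ℂ E]

theorem norm_quotient_mk_apply_le {T : Submodule ℂ E} {D : E →L[ℂ] E} (hD : ∀ x ∈ T, D x ∈ T)
    (z : E) :
    ‖(Submodule.Quotient.mk (D z) : E ⧸ T)‖ ≤ ‖D‖ * ‖(Submodule.Quotient.mk z : E ⧸ T)‖ := by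
  have key : ∀ ε : ℝ, 0 < ε → ‖(Submodule.Quotient.mk (D z) : E ⧸ T)‖ ≤
      ‖D‖ * (‖(Submodule.Quotient.mk z : E ⧸ T)‖ + ε) := by
    intro ε hε
    obtain ⟨x, hx, hx'⟩ := Submodule.Quotient.norm_mk_lt (S := T) (Submodule.Quotient.mk z) hε
    have h : (Submodule.Quotient.mk (D z) : E ⧸ T) = Submodule.Quotient.mk (D x) := by
      rw [Submodule.Quotient.eq] at hx ⊢
      rw [← map_sub, ← neg_sub, map_neg]
      exact T.neg_mem (hD _ hx)
    rw [h]
    refine (Submodule.Quotient.norm_mk_le (S := T) _).trans ((D.le_opNorm x).trans ?_)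
    gcongr
  have hc : Continuous fun ε : ℝ => ‖D‖ * (‖(Submodule.Quotient.mk z : E ⧸ T)‖ + ε) := by fun_prop
  have hlim := (hc.tendsto 0).mono_left (nhdsWithin_le_nhds (s := Set.Ioi (0 : ℝ)))
  simp only [add_zero] at hlim
  exact ge_of_tendsto hlim (Filter.eventually_of_mem self_mem_nhdsWithin key)

/-- If `D Y - Y D = c Y` on `F` modulo a closed subspace `T` and `|c| > 2 ‖D‖`, then `Y` maps `F`
into `T`. -/
theorem apply_mem_of_commutator_eq_smul {F T : Submodule ℂ E} (hT : IsClosed (T : Set E))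
    {D Y : E →L[ℂ] E} {c : ℂ} (hDF : ∀ x ∈ F, D x ∈ F) (hDT : ∀ x ∈ T, D x ∈ T)
    (hY : ∀ x ∈ F, D (Y x) - Y (D x) - c • Y x ∈ T) (hc : 2 * ‖D‖ < ‖c‖) :
    ∀ x ∈ F, Y x ∈ T := by
  have hc0 : 0 < ‖c‖ := lt_of_le_of_lt (by positivity) hc
  set r := 2 * ‖D‖ / ‖c‖ with hr
  have hr0 : 0 ≤ r := by positivity
  have hr1 : r < 1 := (div_lt_one hc0).2 hc
  -- Modulo `T`, c Yx = DYx - YDx. Applying a bound for `Y` on `F` to both terms improves it by the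
  -- factor r = 2‖D‖/‖c‖ < 1.
  have key : ∀ n : ℕ, ∀ x ∈ F,
      ‖(Submodule.Quotient.mk (Y x) : E ⧸ T)‖ ≤ r ^ n * (‖Y‖ * ‖x‖) := by
    intro n
    induction n with
    | zero =>
      intro x _
      rw [pow_zero, one_mul]
      exact (Submodule.Quotient.norm_mk_le (S := T) _).trans (Y.le_opNorm x)
    | succ n ih =>
      intro x hx
      have h1 : c • (Submodule.Quotient.mk (Y x) : E ⧸ T) =
          Submodule.Quotient.mk (D (Y x)) - Submodule.Quotient.mk (Y (D x)) := by
        rw [← Submodule.Quotient.mk_smul, ← Submodule.Quotient.mk_sub, eq_comm,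
          Submodule.Quotient.eq]
        exact hY x hx
      have h2 : ‖c‖ * ‖(Submodule.Quotient.mk (Y x) : E ⧸ T)‖ ≤
          2 * ‖D‖ * (r ^ n * (‖Y‖ * ‖x‖)) := by
        rw [← norm_smul, h1]
        refine (norm_sub_le _ _).trans ?_
        have h3 := (norm_quotient_mk_apply_le hDT (Y x)).trans
          (mul_le_mul_of_nonneg_left (ih x hx) (norm_nonneg D))
        have h4 : r ^ n * (‖Y‖ * ‖D x‖) ≤ r ^ n * (‖Y‖ * (‖D‖ * ‖x‖)) := by
          gcongr
          exact D.le_opNorm x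
        have h5 := (ih (D x) (hDF x hx)).trans h4
        linarith
      have h6 : ‖(Submodule.Quotient.mk (Y x) : E ⧸ T)‖ ≤
          (2 * ‖D‖ * (r ^ n * (‖Y‖ * ‖x‖))) / ‖c‖ := by
        rw [le_div_iff₀ hc0]
        linarith
      refine h6.trans (le_of_eq ?_)
      rw [hr, pow_succ]
      ring
  intro x hx
  have hlim : Filter.Tendsto (fun n : ℕ => r ^ n * (‖Y‖ * ‖x‖)) Filter.atTop (nhds 0) := by
    simpa using (tendsto_pow_atTop_nhds_zero_of_lt_one hr0 hr1).mul_const (‖Y‖ * ‖x‖)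
  have h0 : ‖(Submodule.Quotient.mk (Y x) : E ⧸ T)‖ ≤ 0 :=
    ge_of_tendsto' hlim fun n => key n x hx
  have := hT
  exact (Submodule.Quotient.mk_eq_zero T).1 (norm_eq_zero.1 (le_antisymm h0 (norm_nonneg _)))

end QuotientNorm

/-! ### Eigenvectors of ad h act nilpotently on the graded pieces -/

section Core

variable {L : Type u} [BanachLieAlgebra L]

open BanachLieAlgebra

theorem isClosed_lowerFiltration {M E : Submodule ℂ L} (hM : IsClosed (M : Set L)) (n : ℕ) :
    IsClosed (lowerFiltration M E n : Set L) := by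
  induction n with
  | zero => exact hM
  | succ n ih =>
    have h : (lowerFiltration M E (n + 1) : Set L) =
        (lowerFiltration M E n : Set L) ∩ ⋂ e : E, bracketCLM L e.1 ⁻¹' lowerFiltration M E n := by
      ext x
      simp [mem_lowerFiltration_succ]
    rw [h]
    exact ih.inter (isClosed_iInter fun e => ih.preimage (bracketCLM L e.1).continuous)

section

variable {M E : Submodule ℂ L} (hM : ∀ m ∈ M, ∀ x ∈ M, ⁅m, x⁆ ∈ M)
  (hE : ∀ m ∈ M, ∀ x ∈ E, ⁅m, x⁆ ∈ E)

theorem iterate_lie_mem_lowerFiltration {y : L} (hy : y ∈ E) (k : ℕ) : ∀ i, ∀ x ∈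
    lowerFiltration M E (i + k), (fun x => ⁅y, x⁆)^[k] x ∈ lowerFiltration M E i := by
  induction k with
  | zero => intro i x hx; exact hx
  | succ k ih =>
    intro i x hx
    rw [Function.iterate_succ_apply']
    exact lie_mem_lowerFiltration hy (ih (i + 1) x (by rwa [add_assoc, add_comm 1]))

include hM hE in
-- By the Leibniz rule, moving ad h past one factor ad y produces c·ad y plus the bracket with an
-- element of `M`. The latter preserves the filtration instead of lowering it by one, so the error
-- lies one step deeper.
theorem lie_iterate_sub_mem_lowerFiltration {h y : L} (hy : y ∈ E) {c : ℂ}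
    (hc : ⁅h, y⁆ - c • y ∈ M) (k : ℕ) : ∀ i, ∀ x ∈ lowerFiltration M E (i + k),
    ⁅h, (fun x => ⁅y, x⁆)^[k] x⁆ - (fun x => ⁅y, x⁆)^[k] ⁅h, x⁆ -
      ((k : ℂ) * c) • (fun x => ⁅y, x⁆)^[k] x ∈ lowerFiltration M E (i + 1) := by
  induction k with
  | zero => intro i x hx; simp
  | succ k ih =>
    intro i x hx
    have hx' : x ∈ lowerFiltration M E (i + 1 + k) := by rwa [add_assoc, add_comm 1]
    simp only [Function.iterate_succ_apply']
    set z := (fun x => ⁅y, x⁆)^[k] x with hz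
    set w := (fun x => ⁅y, x⁆)^[k] ⁅h, x⁆ with hw
    have h1 := lie_mem_lowerFiltration hy (ih (i + 1) x hx')
    have h2 := lie_mem_lowerFiltration_of_mem hM hE (i + 1) hc
      (iterate_lie_mem_lowerFiltration hy k (i + 1) x hx')
    convert add_mem h1 h2 using 1
    rw [← hz, ← hw, leibniz_lie, lie_sub, lie_sub, sub_lie, smul_lie, lie_smul]
    push_cast
    module

include hM hE in
/-- An eigenvector, modulo `M`, of some `ad h` with nonzero eigenvalue acts nilpotently on the
graded pieces of the decreasing filtration: otherwise the eigenvalues of `ad h` on the graded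
pieces would be unbounded. -/
theorem exists_iterate_lie_mem_of_eigenvector (hMc : IsClosed (M : Set L)) {h y : L} (hh : h ∈ M)
    (hy : y ∈ E) {c : ℂ} (hc0 : c ≠ 0) (hc : ⁅h, y⁆ - c • y ∈ M) :
    ∃ k, ∀ i, ∀ x ∈ lowerFiltration M E (i + k),
      (fun x => ⁅y, x⁆)^[k] x ∈ lowerFiltration M E (i + 1) := by
  -- Chosen so that the eigenvalue kc of the commutator with ad h exceeds 2‖ad h‖ in modulus.
  obtain ⟨k, hk⟩ := exists_nat_gt (2 * ‖bracketCLM L h‖ / ‖c‖)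
  refine ⟨k, fun i => ?_⟩
  have hpow : ∀ x, (bracketCLM L y ^ k) x = (fun x => ⁅y, x⁆)^[k] x := by
    intro x
    rw [FunLike.coe_pow_eq_iterate]
    rfl
  have := apply_mem_of_commutator_eq_smul (F := lowerFiltration M E (i + k))
    (T := lowerFiltration M E (i + 1)) (isClosed_lowerFiltration hMc _)
    (D := bracketCLM L h) (Y := bracketCLM L y ^ k) (c := k * c)
    (fun x hx => lie_mem_lowerFiltration_of_mem hM hE _ hh hx)
    (fun x hx => lie_mem_lowerFiltration_of_mem hM hE _ hh hx)
    (fun x hx => by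
      rw [hpow, hpow]
      exact lie_iterate_sub_mem_lowerFiltration hM hE hy hc k i x hx)
    (by
      rw [norm_mul, Complex.norm_natCast]
      exact (div_lt_iff₀ (norm_pos_iff.2 hc0)).1 hk)
  intro x hx
  rw [← hpow]
  exact this x hx

include hM hE in
-- The automorphism exp(ad m) preserves every step of the filtration, so conjugating by it keeps the
-- nilpotency with the same exponent `k`.
theorem iterate_lie_innerAut_mem (hMc : IsClosed (M : Set L)) {m y : L} (hm : m ∈ M) {k : ℕ}
    (hy : ∀ i, ∀ x ∈ lowerFiltration M E (i + k),
      (fun x => ⁅y, x⁆)^[k] x ∈ lowerFiltration M E (i + 1)) :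
    ∀ i, ∀ x ∈ lowerFiltration M E (i + k),
      (fun x => ⁅innerAut m y, x⁆)^[k] x ∈ lowerFiltration M E (i + 1) := by
  have hiter : ∀ (k : ℕ) (x : L), (fun x => ⁅innerAut m y, x⁆)^[k] (innerAut m x) =
      innerAut m ((fun x => ⁅y, x⁆)^[k] x) := by
    intro k x
    induction k with
    | zero => rfl
    | succ k ih => rw [Function.iterate_succ_apply', ih, Function.iterate_succ_apply', LieHom.map_lie]
  have hinv : ∀ m ∈ M, ∀ n, ∀ x ∈ lowerFiltration M E n, innerAut m x ∈ lowerFiltration M E n :=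
    fun m hm n x hx => innerAut_mem (isClosed_lowerFiltration hMc n)
      (fun y hy => lie_mem_lowerFiltration_of_mem hM hE n hm hy) hx
  intro i x hx
  rw [← innerAut_innerAut_neg m x, hiter]
  exact hinv m hm _ _ (hy i _ (hinv (-m) (M.neg_mem hm) _ _ hx))

end

end Core

/-! ### The alternative given by Engel's theorem -/

section Engel

theorem exists_hasEigenvalue_ne_zero {V : Type*} [AddCommGroup V] [Module ℂ V]
    [FiniteDimensional ℂ V] {f : Module.End ℂ V} (hf : ¬ IsNilpotent f) :
    ∃ c : ℂ, c ≠ 0 ∧ f.HasEigenvalue c := by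
  by_contra hcon
  push Not at hcon
  apply hf
  have h0 : ∀ c : ℂ, c ≠ 0 → f.maxGenEigenspace c = ⊥ := by
    intro c hc
    by_contra h
    rw [Module.End.maxGenEigenspace_eq_genEigenspace_finrank] at h
    exact hcon c hc (Module.End.hasEigenvalue_of_hasGenEigenvalue (k := Module.finrank ℂ V) h)
  have h1 : f.maxGenEigenspace 0 = ⊤ := by
    rw [eq_top_iff, ← Module.End.iSup_maxGenEigenspace_eq_top f]
    refine iSup_le fun c => ?_
    rcases eq_or_ne c 0 with rfl | hc
    · exact le_rfl
    · rw [h0 c hc]; exact bot_le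
  refine ⟨Module.finrank ℂ V, LinearMap.ext fun x => ?_⟩
  have hx : x ∈ f.maxGenEigenspace 0 := h1 ▸ Submodule.mem_top
  rw [Module.End.maxGenEigenspace_eq_genEigenspace_finrank, Module.End.mem_genEigenspace_nat] at hx
  simpa using hx

variable {L : Type u} [LieRing L] [LieAlgebra ℂ L]

/-- Either some vector outside `M` is fixed by `M` modulo `M`, or there is a minimal `M`-invariant
subspace above `M` on which some element of `M` has an eigenvector with nonzero eigenvalue. -/
theorem exists_fixed_vector_or_eigenvector (M : LieSubalgebra ℂ L)
    [Module.Finite ℂ (L ⧸ M.toSubmodule)] (hM : M ≠ ⊤) :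
    (∃ v ∉ M, ∀ m ∈ M, ⁅m, v⁆ ∈ M) ∨
    ∃ E : Submodule ℂ L, M.toSubmodule ≤ E ∧ (∀ m ∈ M, ∀ x ∈ E, ⁅m, x⁆ ∈ E) ∧
      (∀ E' : Submodule ℂ L, M.toSubmodule < E' → (∀ m ∈ M, ∀ x ∈ E', ⁅m, x⁆ ∈ E') →
        E' ≤ E → E' = E) ∧
      ∃ h ∈ M, ∃ y ∈ E, y ∉ M ∧ ∃ c : ℂ, c ≠ 0 ∧ ⁅h, y⁆ - c • y ∈ M := by
  let Q := L ⧸ M.toLieSubmodule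
  have hfin : Module.Finite ℂ Q := inferInstanceAs (Module.Finite ℂ (L ⧸ M.toSubmodule))
  let π : L →ₗ⁅ℂ, M⁆ Q := LieSubmodule.Quotient.mk' M.toLieSubmodule
  have hπ : ∀ x, π x = 0 ↔ x ∈ M := fun x =>
    LieSubmodule.Quotient.mk_eq_zero' (N := M.toLieSubmodule)
  have hsurj : Function.Surjective π := Submodule.Quotient.mk_surjective _
  obtain ⟨v, hv⟩ : ∃ v, v ∉ M := by
    by_contra h
    push Not at h
    exact hM (eq_top_iff.2 fun x _ => h x)
  have hne : (⊤ : LieSubmodule ℂ M Q) ≠ ⊥ := by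
    intro h
    have : π v ∈ (⊤ : LieSubmodule ℂ M Q) := trivial
    rw [h, LieSubmodule.mem_bot, hπ] at this
    exact hv this
  obtain ⟨W, hW, -⟩ := (IsAtomic.eq_bot_or_exists_atom_le (⊤ : LieSubmodule ℂ M Q)).resolve_left hne
  have hWn : Nontrivial W := (LieSubmodule.nontrivial_iff_ne_bot ℂ M Q).2 hW.1
  -- `W` is a minimal submodule of L/M. If all elements act nilpotently, Engel's theorem gives a
  -- nonzero vector killed by `M`; otherwise some element has a nonzero eigenvalue on `W`.
  by_cases hnil : ∀ h : M, IsNilpotent (LieModule.toEnd ℂ M W h)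
  · left
    have : LieModule.IsNilpotent M W := (LieModule.isNilpotent_iff_forall' (R := ℂ)).2 hnil
    have := LieModule.nontrivial_max_triv_of_isNilpotent ℂ M W
    obtain ⟨⟨w, hw⟩, hw0⟩ := exists_ne (0 : LieModule.maxTrivSubmodule ℂ M W)
    obtain ⟨x, hx⟩ := hsurj w.1
    refine ⟨x, fun hxM => hw0 ?_, fun m hm => ?_⟩
    · rw [← hπ, hx] at hxM
      exact Subtype.ext (Subtype.ext hxM)
    · rw [← hπ]
      have h1 := LieModuleHom.map_lie π ⟨m, hm⟩ x
      have h2 := congrArg Subtype.val ((LieModule.mem_maxTrivSubmodule _ _ _ w).1 hw ⟨m, hm⟩)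
      rw [hx] at h1
      exact h1.trans h2
  · right
    push Not at hnil
    obtain ⟨h, hh⟩ := hnil
    obtain ⟨c, hc0, hc⟩ := exists_hasEigenvalue_ne_zero hh
    obtain ⟨w, hw⟩ := hc.exists_hasEigenvector
    refine ⟨(W.comap π).toSubmodule, ?_, ?_, ?_, h.1, h.2, ?_⟩
    · intro x hx
      change π x ∈ W
      rw [(hπ x).2 hx]
      exact W.zero_mem
    · intro m hm x hx
      exact (W.comap π).lie_mem (x := ⟨m, hm⟩) hx
    · intro E' hE' hinv hle
      let E'' : LieSubmodule ℂ M L := { E' with lie_mem := fun {m x} hx => hinv m.1 m.2 x hx }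
      have hle' : E''.map π ≤ W := by
        rw [LieSubmodule.map_le_iff_le_comap]
        exact hle
      have hne' : E''.map π ≠ ⊥ := by
        intro h0
        obtain ⟨x, hx, hxM⟩ := Set.exists_of_ssubset hE'
        have : π x ∈ E''.map π := LieSubmodule.mem_map_of_mem hx
        rw [h0, LieSubmodule.mem_bot, hπ] at this
        exact hxM this
      have heq := hW.le_iff_eq hne' |>.1 hle'
      refine le_antisymm hle fun x hx => ?_
      have hx' : π x ∈ E''.map π := heq ▸ hx
      obtain ⟨z, hz, hzx⟩ := (LieSubmodule.mem_map _).1 hx'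
      have hd : x - z ∈ M := by
        rw [← hπ, map_sub, hzx, sub_self]
      have := E'.add_mem (hE'.le hd) hz
      rwa [sub_add_cancel] at this
    · obtain ⟨y, hy⟩ := hsurj w.1
      refine ⟨y, ?_, ?_, c, hc0, ?_⟩
      · change π y ∈ W
        rw [hy]
        exact w.2
      · intro hyM
        rw [← hπ, hy] at hyM
        exact hw.2 (Subtype.ext hyM)
      · rw [← hπ, map_sub, map_smul, hy]
        have h1 := LieModuleHom.map_lie π h y
        have h2 := congrArg Subtype.val hw.apply_eq_smul
        rw [hy] at h1
        exact sub_eq_zero.2 (h1.trans h2)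

end Engel

/-! ### Stabilization of the decreasing filtration at an ideal -/

section Stabilization

variable {L : Type u} [LieRing L] [LieAlgebra ℂ L] {M E : Submodule ℂ L}

theorem foldr_lie_mem_lowerFiltration (l : List L) (hl : ∀ e ∈ l, e ∈ E) : ∀ {i : ℕ} {x : L},
    x ∈ lowerFiltration M E (i + l.length) →
    l.foldr (fun e x => ⁅e, x⁆) x ∈ lowerFiltration M E i := by
  induction l with
  | nil => intro i x hx; exact hx
  | cons e l ih =>
    intro i x hx
    rw [List.foldr_cons]
    refine lie_mem_lowerFiltration (hl e (by simp)) (ih (fun e he => hl e (by simp [he])) ?_)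
    rwa [List.length_cons, ← add_assoc, add_right_comm] at hx

/-- A product of `K - t` elements of `E` sends `x` into step `t` a priori. Induction on `t`,
starting from the hypothesis at `t = 0`, improves this to step `t + 1`; the empty product, `t = K`,
is the claim. -/
theorem lowerFiltration_le_succ_of_foldr {K : ℕ}
    (hK : ∀ l : List L, (∀ e ∈ l, e ∈ E) → l.length = K → ∀ x ∈ lowerFiltration M E K,
      l.foldr (fun e x => ⁅e, x⁆) x ∈ lowerFiltration M E 1) :
    lowerFiltration M E K ≤ lowerFiltration M E (K + 1) := by
  intro x hx
  have key : ∀ t r, t + r = K → ∀ l : List L, (∀ e ∈ l, e ∈ E) → l.length = r →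
      l.foldr (fun e x => ⁅e, x⁆) x ∈ lowerFiltration M E (t + 1) := by
    intro t
    induction t with
    | zero => intro r hr l hl hlen; exact hK l hl (by omega) x hx
    | succ t ih =>
      intro r hr l hl hlen
      refine mem_lowerFiltration_succ.2 ⟨foldr_lie_mem_lowerFiltration l hl ?_, fun e he => ?_⟩
      · rwa [hlen, hr]
      · exact ih (r + 1) (by omega) (e :: l) (by simpa [he] using hl) (by simpa using hlen)
  exact key K 0 rfl [] (by simp) rfl

/-- If the decreasing filtration stabilizes, it stabilizes at an ideal. -/
theorem lie_mem_of_lowerFiltration_le_succ (hME : M < E)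
    (hmax : ∀ T : LieSubalgebra ℂ L, M < T.toSubmodule → T = ⊤) {K : ℕ}
    (hK : lowerFiltration M E K ≤ lowerFiltration M E (K + 1)) (x : L) {y : L}
    (hy : y ∈ lowerFiltration M E K) : ⁅x, y⁆ ∈ lowerFiltration M E K := by
  -- The normalizer of the stable step: a subalgebra containing `E`, hence everything.
  let T : LieSubalgebra ℂ L :=
    { carrier := {x | ∀ y ∈ lowerFiltration M E K, ⁅x, y⁆ ∈ lowerFiltration M E K}
      add_mem' := fun {a b} ha hb y hy => by rw [add_lie]; exact add_mem (ha y hy) (hb y hy)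
      zero_mem' := fun y _ => by rw [zero_lie]; exact zero_mem _
      smul_mem' := fun c a ha y hy => by rw [smul_lie]; exact Submodule.smul_mem _ c (ha y hy)
      lie_mem' := fun {a b} ha hb y hy => by
        rw [lie_lie]
        exact sub_mem (ha _ (hb y hy)) (hb _ (ha y hy)) }
  have hET : E ≤ T.toSubmodule := fun e he y hy => lie_mem_lowerFiltration he (hK hy)
  have hT := hmax T (hME.trans_le hET)
  have hx : x ∈ T := hT ▸ LieSubalgebra.mem_top x
  exact hx y hy

end Stabilization

/-! ### Closed ideals of finite codimension inside maximal subalgebras -/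

namespace ClosedLieSubalgebra

open BanachLieAlgebra

variable {L : Type u} [BanachLieAlgebra L]

/-- A closed subspace invariant under the adjoint action, as a closed Lie subalgebra. -/
def ofInvariant (H : Submodule ℂ L) (hH : IsClosed (H : Set L))
    (hinv : ∀ x : L, ∀ y ∈ H, ⁅x, y⁆ ∈ H) : ClosedLieSubalgebra L where
  toLieSubalgebra := { H with lie_mem' := fun {x y} _ hy => hinv x y hy }
  isClosed := hH

theorem isIdeal_ofInvariant (H : Submodule ℂ L) (hH : IsClosed (H : Set L))
    (hinv : ∀ x : L, ∀ y ∈ H, ⁅x, y⁆ ∈ H) : (ofInvariant H hH hinv).IsIdeal := hinv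

theorem isClosed_of_finiteCodim {S : ClosedLieSubalgebra L} (hS : S.FiniteCodim)
    {T : Submodule ℂ L} (h : S.toLieSubalgebra.toSubmodule ≤ T) : IsClosed (T : Set L) := by
  have : FiniteDimensional ℂ (L ⧸ S.toLieSubalgebra.toSubmodule) := hS
  exact Submodule.isClosed_mono_of_finiteDimensional_quotient S.isClosed h

theorem eq_top_iff' {S : ClosedLieSubalgebra L} : S = ⊤ ↔ S.toLieSubalgebra = ⊤ :=
  ⟨fun h => h ▸ rfl, fun h => ClosedLieSubalgebra.ext h⟩

/-- Every subspace above a closed one of finite codimension is closed, so maximality among closed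
subalgebras is maximality among all subalgebras. -/
theorem eq_top_of_maximal_of_lt {M : ClosedLieSubalgebra L} (hmax : Maximal (· ≠ ⊤) M)
    (hfin : M.FiniteCodim) (T : LieSubalgebra ℂ L)
    (h : M.toLieSubalgebra.toSubmodule < T.toSubmodule) : T = ⊤ := by
  by_contra hT
  let T' : ClosedLieSubalgebra L := ⟨T, isClosed_of_finiteCodim hfin h.le⟩
  exact h.not_ge (hmax.2 (y := T') (fun h' => hT (eq_top_iff'.1 h')) h.le)

/-- A maximal closed Lie subalgebra of finite codimension contains a closed Lie ideal of finite
codimension. -/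
theorem exists_isIdeal_le_of_maximal {M : ClosedLieSubalgebra L} (hmax : Maximal (· ≠ ⊤) M)
    (hfin : M.FiniteCodim) : ∃ I : ClosedLieSubalgebra L, I.IsIdeal ∧ I ≤ M ∧ I.FiniteCodim := by
  have : Module.Finite ℂ (L ⧸ M.toLieSubalgebra.toSubmodule) := hfin
  have htop := eq_top_of_maximal_of_lt hmax hfin
  have hM : ∀ m ∈ M.toLieSubalgebra, ∀ x ∈ M.toLieSubalgebra, ⁅m, x⁆ ∈ M.toLieSubalgebra :=
    fun m hm x hx => M.toLieSubalgebra.lie_mem hm hx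
  rcases exists_fixed_vector_or_eigenvector M.toLieSubalgebra
    (fun h => hmax.1 (eq_top_iff'.2 h)) with ⟨v, hv, hfix⟩ |
      ⟨E, hME, hE, hmin, h, hh, y, hyE, hyM, c, hc0, hc⟩
  · have hfix' : ∀ m ∈ M.toLieSubalgebra, ⁅v, m⁆ ∈ M.toLieSubalgebra := fun m hm => by
      rw [← lie_skew]
      exact neg_mem (hfix m hm)
    let T : LieSubalgebra ℂ L :=
      { M.toLieSubalgebra.toSubmodule ⊔ Submodule.span ℂ {v} with
        lie_mem' := by
          intro a b ha hb
          obtain ⟨m, hm, a', ha', rfl⟩ := Submodule.mem_sup.1 ha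
          obtain ⟨n, hn, b', hb', rfl⟩ := Submodule.mem_sup.1 hb
          obtain ⟨s, rfl⟩ := Submodule.mem_span_singleton.1 ha'
          obtain ⟨t, rfl⟩ := Submodule.mem_span_singleton.1 hb'
          refine Submodule.mem_sup_left ?_
          have h1 : ⁅m + s • v, n + t • v⁆ = ⁅m, n⁆ + t • ⁅m, v⁆ + s • ⁅v, n⁆ := by
            simp only [lie_add, add_lie, smul_lie, lie_smul, lie_self, smul_zero, add_zero]
            abel
          rw [h1]
          exact add_mem (add_mem (hM m hm n hn) (Submodule.smul_mem _ _ (hfix m hm)))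
            (Submodule.smul_mem _ _ (hfix' n hn)) }
    have hT : T = ⊤ := by
      refine htop T (lt_of_le_of_ne le_sup_left fun h => hv ?_)
      change v ∈ M.toLieSubalgebra.toSubmodule
      rw [h]
      exact Submodule.mem_sup_right (Submodule.mem_span_singleton_self v)
    refine ⟨M, fun x z hz => ?_, le_rfl, hfin⟩
    have hx : x ∈ T := hT ▸ LieSubalgebra.mem_top x
    obtain ⟨m, hm, a, ha, rfl⟩ := Submodule.mem_sup.1 hx
    obtain ⟨s, rfl⟩ := Submodule.mem_span_singleton.1 ha
    rw [add_lie, smul_lie]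
    exact add_mem (hM m hm z hz) (Submodule.smul_mem _ _ (hfix' z hz))
  · set M₀ := M.toLieSubalgebra.toSubmodule with hM₀
    have hlt : M₀ < E := lt_of_le_of_ne hME fun h => hyM (by
      change y ∈ M₀
      rw [h]
      exact hyE)
    obtain ⟨k, hk⟩ := exists_iterate_lie_mem_of_eigenvector (M := M₀) hM hE M.isClosed hh hyE hc0 hc
    let N : Set L := {y | y ∈ E ∧ ∀ i, ∀ x ∈ lowerFiltration M₀ E (i + k),
      (fun x => ⁅y, x⁆)^[k] x ∈ lowerFiltration M₀ E (i + 1)}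
    have hEc : IsClosed (E : Set L) := isClosed_of_finiteCodim hfin hME
    have hNaut : ∀ m ∈ M₀, ∀ x ∈ M₀ ⊔ Submodule.span ℂ N,
        innerAut m x ∈ M₀ ⊔ Submodule.span ℂ N := by
      intro m hm x hx
      obtain ⟨a, ha, b, hb, rfl⟩ := Submodule.mem_sup.1 hx
      rw [map_add]
      refine add_mem (Submodule.mem_sup_left (innerAut_mem M.isClosed (hM m hm) ha))
        (Submodule.mem_sup_right ?_)
      have hle : Submodule.span ℂ N ≤
          (Submodule.span ℂ N).comap (innerAut m : L →ₗ[ℂ] L) := by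
        refine Submodule.span_le.2 fun z hz => Submodule.subset_span ?_
        exact ⟨innerAut_mem hEc (hE m hm) hz.1,
          iterate_lie_innerAut_mem (M := M₀) hM hE M.isClosed hm hz.2⟩
      exact hle hb
    -- The left side is invariant under exp(ad tm) for `m` in `M`, hence by differentiation at t = 0
    -- under ad m. It contains `y`, which lies outside `M`, so minimality of `E` applies.
    have hspan : M₀ ⊔ Submodule.span ℂ N = E := by
      refine hmin _ (lt_of_le_of_ne le_sup_left fun h => hyM ?_) (fun m hm x hx => ?_)
        (sup_le hME (Submodule.span_le.2 fun z hz => hz.1))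
      · change y ∈ M₀
        rw [h]
        exact Submodule.mem_sup_right (Submodule.subset_span ⟨hyE, hk⟩)
      · exact lie_mem_of_innerAut_mem (isClosed_of_finiteCodim hfin le_sup_left) fun t =>
          hNaut (t • m) (M₀.smul_mem t hm) x hx
    obtain ⟨q, hq⟩ := exists_upperFiltration_eq_top hlt htop
    obtain ⟨K, hK⟩ := exists_foldr_lie_mem hM hE hME hq (fun z hz => hz.1)
      (fun z hz => hz.2) hspan.ge
    have hstab := lowerFiltration_le_succ_of_foldr hK
    refine ⟨ofInvariant (lowerFiltration M₀ E K) (isClosed_lowerFiltration M.isClosed K)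
      (fun x y hy => lie_mem_of_lowerFiltration_le_succ hlt htop hstab x hy),
      isIdeal_ofInvariant _ _ _, ?_, ?_⟩
    · exact lowerFiltration_antitone (Nat.zero_le K)
    · exact finite_quotient_lowerFiltration hM hE hME K

end ClosedLieSubalgebra

/-! ### Pulling back along homomorphisms with dense image -/

namespace ClosedLieSubalgebra

open BanachLieAlgebra

variable {L M N : Type u} [BanachLieAlgebra L] [BanachLieAlgebra M] [BanachLieAlgebra N]

theorem FiniteCodim.mono {S T : ClosedLieSubalgebra L} (hS : S.FiniteCodim) (h : S ≤ T) :
    T.FiniteCodim :=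
  Submodule.CoFG.of_le (S := S.toLieSubalgebra.toSubmodule) (T := T.toLieSubalgebra.toSubmodule) h hS

/-- The preimage of a closed Lie subalgebra. -/
def comap (f : L →ₗ⁅ℂ⁆ M) (hf : Continuous f) (S : ClosedLieSubalgebra M) :
    ClosedLieSubalgebra L where
  toLieSubalgebra := S.toLieSubalgebra.comap f
  isClosed := S.isClosed.preimage hf

theorem mem_comap {f : L →ₗ⁅ℂ⁆ M} {hf : Continuous f} {S : ClosedLieSubalgebra M} {x : L} :
    x ∈ (comap f hf S).toLieSubalgebra ↔ f x ∈ S.toLieSubalgebra := Iff.rfl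

theorem FiniteCodim.comap {f : L →ₗ⁅ℂ⁆ M} {hf : Continuous f} {S : ClosedLieSubalgebra M}
    (hS : S.FiniteCodim) : (comap f hf S).FiniteCodim := by
  have : Module.Finite ℂ (M ⧸ S.toLieSubalgebra.toSubmodule) := hS
  have h := Submodule.CoFG.ker (S.toLieSubalgebra.toSubmodule.mkQ ∘ₗ (f : L →ₗ[ℂ] M))
  rwa [LinearMap.ker_comp, Submodule.ker_mkQ] at h

theorem IsIdeal.comap {f : L →ₗ⁅ℂ⁆ M} {hf : Continuous f} {S : ClosedLieSubalgebra M}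
    (hS : S.IsIdeal) : (comap f hf S).IsIdeal := fun x y hy => by
  rw [mem_comap, LieHom.map_lie]
  exact hS _ _ hy

theorem mem_of_eq_top {S : ClosedLieSubalgebra L} (h : S = ⊤) (x : L) : x ∈ S.toLieSubalgebra :=
  h ▸ LieSubalgebra.mem_top x

theorem eq_top_of_forall_mem {S : ClosedLieSubalgebra L} (h : ∀ x, x ∈ S.toLieSubalgebra) :
    S = ⊤ :=
  eq_top_iff'.2 (eq_top_iff.2 fun x _ => h x)

theorem comap_ne_top {f : L →ₗ⁅ℂ⁆ M} {hf : Continuous f} (hd : DenseRange f)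
    {S : ClosedLieSubalgebra M} (hS : S ≠ ⊤) : comap f hf S ≠ ⊤ := by
  intro h
  refine hS (eq_top_of_forall_mem fun y => ?_)
  have hle : Set.range f ⊆ S.toLieSubalgebra := by
    rintro _ ⟨x, rfl⟩
    exact mem_of_eq_top h x
  exact closure_minimal hle S.isClosed (hd y)

/-- Closed Lie subalgebras of finite codimension lie in maximal ones, for any property. -/
theorem exists_le_maximal {p : ClosedLieSubalgebra L → Prop} {S : ClosedLieSubalgebra L} (hp : p S)
    (hS : S.FiniteCodim) : ∃ T, S ≤ T ∧ Maximal p T := by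
  let S₀ := S.toLieSubalgebra.toSubmodule
  have hfin : Module.Finite ℂ (L ⧸ S₀) := hS
  let F : ClosedLieSubalgebra L → Submodule ℂ (L ⧸ S₀) := fun T =>
    T.toLieSubalgebra.toSubmodule.map S₀.mkQ
  obtain ⟨V, ⟨T, ⟨hST, hpT⟩, rfl⟩, hmax⟩ := (wellFounded_gt (α := Submodule ℂ (L ⧸ S₀))).has_min
    (F '' {T | S ≤ T ∧ p T}) ⟨F S, S, ⟨le_rfl, hp⟩, rfl⟩
  refine ⟨T, hST, hpT, fun T' hpT' hTT' => ?_⟩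
  have hle : F T ≤ F T' := Submodule.map_mono hTT'
  have heq : F T = F T' := by
    by_contra hne
    exact hmax (F T') ⟨T', ⟨hST.trans hTT', hpT'⟩, rfl⟩ (lt_of_le_of_ne hle hne)
  have h := congrArg (Submodule.comap S₀.mkQ) heq
  rw [Submodule.comap_map_mkQ, Submodule.comap_map_mkQ, sup_eq_right.2 (show S₀ ≤ _ from hST),
    sup_eq_right.2 (show S₀ ≤ _ from hST.trans hTT')] at h
  exact h.ge

theorem continuous_lie : Continuous fun p : L × L => ⁅p.1, p.2⁆ :=
  (bracketCLM L).continuous₂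

/-- The closure of the image of a closed Lie subalgebra. -/
def closureMap (f : L →ₗ⁅ℂ⁆ M) (T : ClosedLieSubalgebra L) : ClosedLieSubalgebra M where
  toLieSubalgebra :=
    { (T.toLieSubalgebra.toSubmodule.map (f : L →ₗ[ℂ] M)).topologicalClosure with
      lie_mem' := fun {x y} hx hy => by
        refine map_mem_closure₂ continuous_lie hx hy ?_
        rintro _ ⟨a, ha, rfl⟩ _ ⟨b, hb, rfl⟩
        exact ⟨⁅a, b⁆, T.toLieSubalgebra.lie_mem ha hb, LieHom.map_lie f a b⟩ }
  isClosed := Submodule.isClosed_topologicalClosure _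

theorem map_mem_closureMap (f : L →ₗ⁅ℂ⁆ M) {T : ClosedLieSubalgebra L} {x : L}
    (hx : x ∈ T.toLieSubalgebra) : f x ∈ (closureMap f T).toLieSubalgebra :=
  subset_closure ⟨x, hx, rfl⟩

theorem isIdeal_closureMap {f : L →ₗ⁅ℂ⁆ M} (hd : DenseRange f) {T : ClosedLieSubalgebra L}
    (hT : T.IsIdeal) : (closureMap f T).IsIdeal := by
  intro x y hy
  refine map_mem_closure₂ continuous_lie (hd x) hy ?_
  rintro _ ⟨a, rfl⟩ _ ⟨b, hb, rfl⟩
  exact ⟨⁅a, b⁆, hT a b hb, LieHom.map_lie f a b⟩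

section

variable {f : L →ₗ⁅ℂ⁆ M} {hf : Continuous f} {S : ClosedLieSubalgebra M}

/-- Write T = f⁻¹(S) ⊕ (C ∩ T) with `C` a finite-dimensional complement of f⁻¹(S). Closed plus
finite-dimensional is closed, so taking the closure of f(T) only closes up the first summand, inside
`S`. This is what makes closure of image and preimage transfer maximality. -/
theorem exists_sub_mem_of_mem_closure (hS : S.FiniteCodim) {T : Submodule ℂ L}
    (hT : (comap f hf S).toLieSubalgebra.toSubmodule ≤ T) {z : M}
    (hz : z ∈ (T.map (f : L →ₗ[ℂ] M)).topologicalClosure) :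
    ∃ w ∈ ((comap f hf S).toLieSubalgebra.toSubmodule.map (f : L →ₗ[ℂ] M)).topologicalClosure,
      w ∈ S.toLieSubalgebra ∧ ∃ c ∈ T, z = w + f c ∧
        (f c ∈ S.toLieSubalgebra → c = 0) := by
  set T₀ := (comap f hf S).toLieSubalgebra.toSubmodule with hT₀
  obtain ⟨C, hC⟩ := T₀.exists_isCompl
  have hfin : Module.Finite ℂ (L ⧸ T₀) := hS.comap (hf := hf)
  have hCfin : Module.Finite ℂ C := .of_fg (Submodule.CoFG.fg_of_isCompl hC inferInstance)
  have hCT : FiniteDimensional ℂ (C ⊓ T : Submodule ℂ L) :=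
    Submodule.finiteDimensional_of_le inf_le_left
  set W := (T₀.map (f : L →ₗ[ℂ] M)).topologicalClosure with hW
  have hcl := Submodule.isClosed_sup_finiteDimensional W ((C ⊓ T).map (f : L →ₗ[ℂ] M))
    (Submodule.isClosed_topologicalClosure _)
  have hle : (T.map (f : L →ₗ[ℂ] M)).topologicalClosure ≤ W ⊔ (C ⊓ T).map (f : L →ₗ[ℂ] M) := by
    refine Submodule.topologicalClosure_minimal _ ?_ hcl
    have hTeq : T = T₀ ⊔ C ⊓ T := by
      rw [← sup_inf_assoc_of_le C hT, hC.sup_eq_top, top_inf_eq]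
    conv_lhs => rw [hTeq]
    rw [Submodule.map_sup]
    exact sup_le_sup (Submodule.le_topologicalClosure _) le_rfl
  obtain ⟨w, hw, _, ⟨c, hc, rfl⟩, rfl⟩ := Submodule.mem_sup.1 (hle hz)
  refine ⟨w, hw, ?_, c, hc.2, rfl, fun h => ?_⟩
  · have hWS : W ≤ S.toLieSubalgebra.toSubmodule := by
      refine Submodule.topologicalClosure_minimal _ ?_ S.isClosed
      rintro _ ⟨x, hx, rfl⟩
      exact hx
    exact hWS hw
  · exact (Submodule.mem_bot ℂ).1 (hC.inf_eq_bot ▸ ⟨h, hc.1⟩)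

theorem le_closureMap (hd : DenseRange f) (hS : S.FiniteCodim) {T : ClosedLieSubalgebra L}
    (hT : comap f hf S ≤ T) : S ≤ closureMap f T := by
  intro s hs
  obtain ⟨w, hw, hwS, c, -, rfl, hc⟩ := exists_sub_mem_of_mem_closure (hf := hf) hS
    (T := ⊤) le_top (z := s) (by
      refine closure_mono ?_ (hd s)
      rintro _ ⟨x, rfl⟩
      exact ⟨x, trivial, rfl⟩)
  have hfc : f c ∈ S.toLieSubalgebra := by
    have := sub_mem hs hwS
    rwa [add_sub_cancel_left] at this
  rw [hc hfc, map_zero, add_zero]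
  exact Submodule.topologicalClosure_mono (Submodule.map_mono hT) hw

theorem eq_top_of_closureMap_eq_top (hS : S.FiniteCodim) {T : ClosedLieSubalgebra L}
    (hT : comap f hf S ≤ T) (h : closureMap f T = ⊤) : T = ⊤ := by
  refine eq_top_of_forall_mem fun x => ?_
  obtain ⟨w, -, hwS, c, hcT, hx, -⟩ := exists_sub_mem_of_mem_closure (hf := hf) hS hT
    (mem_of_eq_top h (f x))
  have hxc : x - c ∈ (comap f hf S).toLieSubalgebra := by
    rw [mem_comap, map_sub, hx, add_sub_cancel_right]
    exact hwS
  have := add_mem (hT hxc) hcT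
  rwa [sub_add_cancel] at this

theorem comap_mem_maximalSubalgebras (hd : DenseRange f) (hS : S ∈ maximalSubalgebras M) :
    comap f hf S ∈ maximalSubalgebras L := by
  refine ⟨⟨comap_ne_top hd hS.1.1, fun T hT hle x hx => ?_⟩, hS.2.comap⟩
  exact hS.1.2 (y := closureMap f T) (fun h => hT (eq_top_of_closureMap_eq_top hS.2 hle h))
    (le_closureMap hd hS.2 hle) (map_mem_closureMap f hx)

theorem comap_mem_maximalIdeals (hd : DenseRange f) (hS : S ∈ maximalIdeals M) :
    comap f hf S ∈ maximalIdeals L := by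
  refine ⟨⟨⟨hS.1.1.1.comap, comap_ne_top hd hS.1.1.2⟩, fun T hT hle x hx => ?_⟩, hS.2.comap⟩
  exact hS.1.2 (y := closureMap f T) ⟨isIdeal_closureMap hd hT.1,
    fun h => hT.2 (eq_top_of_closureMap_eq_top hS.2 hle h)⟩
    (le_closureMap hd hS.2 hle) (map_mem_closureMap f hx)

end

theorem continuous_incl (S : ClosedLieSubalgebra L) : Continuous S.toLieSubalgebra.incl :=
  continuous_subtype_val

/-- A homomorphism with values in a closed Lie subalgebra, as a homomorphism to it. -/
def lift (f : N →ₗ⁅ℂ⁆ L) (S : ClosedLieSubalgebra L) (h : ∀ x, f x ∈ S.toLieSubalgebra) :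
    N →ₗ⁅ℂ⁆ S.toLieSubalgebra where
  toFun x := ⟨f x, h x⟩
  map_add' x y := Subtype.ext (map_add f x y)
  map_smul' c x := Subtype.ext (map_smul f c x)
  map_lie' {x y} := Subtype.ext (LieHom.map_lie f x y)

theorem continuous_lift {f : N →ₗ⁅ℂ⁆ L} (hf : Continuous f) (S : ClosedLieSubalgebra L)
    (h : ∀ x, f x ∈ S.toLieSubalgebra) : Continuous (lift f S h) :=
  Continuous.subtype_mk hf h

theorem mem_ofSub {S : ClosedLieSubalgebra L} {T : ClosedLieSubalgebra S.toLieSubalgebra} {x : L} :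
    x ∈ (S.ofSub T).toLieSubalgebra ↔
      ∃ h : x ∈ S.toLieSubalgebra, (⟨x, h⟩ : S.toLieSubalgebra) ∈ T.toLieSubalgebra := by
  constructor
  · rintro ⟨y, hy, rfl⟩
    exact ⟨y.2, hy⟩
  · rintro ⟨h, hx⟩
    exact ⟨⟨x, h⟩, hx, rfl⟩

theorem innerAut_mem_of_isIdeal {A : ClosedLieSubalgebra L} (hA : A.IsIdeal) (x : L) {y : L}
    (hy : y ∈ A.toLieSubalgebra) : innerAut x y ∈ A.toLieSubalgebra :=
  innerAut_mem (T := A.toLieSubalgebra.toSubmodule) A.isClosed (fun z hz => hA x z hz) hy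

end ClosedLieSubalgebra

/-! ### Preradicals, balance and the superposition series -/

namespace SubalgebraMap

open BanachLieAlgebra ClosedLieSubalgebra

variable {R R₁ R₂ : SubalgebraMap.{u}}

/-- The image condition in the definition of a preradical. -/
def MapsDense (R : SubalgebraMap.{u}) : Prop :=
  ∀ (L M : Type u) [BanachLieAlgebra L] [BanachLieAlgebra M] (f : L →ₗ⁅ℂ⁆ M),
    Continuous f → DenseRange f → ∀ x ∈ (R L).toLieSubalgebra, f x ∈ (R M).toLieSubalgebra

/-- The values of `R` on closed ideals are ideals of the whole algebra. -/
theorem MapsDense.isIdeal_ofSub (hR : R.MapsDense) {L : Type u} [BanachLieAlgebra L]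
    {A : ClosedLieSubalgebra L} (hA : A.IsIdeal) : (A.ofSub (R A.toLieSubalgebra)).IsIdeal := by
  intro x y hy
  obtain ⟨hyA, hyR⟩ := mem_ofSub.1 hy
  refine lie_mem_of_innerAut_mem (T := (A.ofSub (R A.toLieSubalgebra)).toLieSubalgebra.toSubmodule)
    (A.ofSub (R A.toLieSubalgebra)).isClosed fun t => ?_
  -- exp(ad tx) restricts to an automorphism of `A`, which may fail to be inner in `A`; it
  -- nevertheless preserves `R A`.
  let g : A.toLieSubalgebra →ₗ⁅ℂ⁆ A.toLieSubalgebra :=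
    lift ((innerAut (t • x)).comp A.toLieSubalgebra.incl) A
      fun z => innerAut_mem_of_isIdeal hA _ z.2
  have hg : Continuous g :=
    continuous_lift (f := (innerAut (t • x)).comp A.toLieSubalgebra.incl)
      (Continuous.comp (g := innerAut (t • x)) (f := A.toLieSubalgebra.incl)
        (continuous_innerAut _) (continuous_incl A)) A _
  have hs : Function.Surjective g := fun z =>
    ⟨⟨innerAut (-(t • x)) z.1, innerAut_mem_of_isIdeal hA _ z.2⟩,
      Subtype.ext (innerAut_innerAut_neg _ _)⟩
  exact mem_ofSub.2 ⟨_, hR _ _ g hg hs.denseRange _ hyR⟩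

/-- The automorphisms exp(ad tx) are surjective, so they preserve `R L`; differentiating at t = 0
shows that `R L` is an ideal. -/
theorem MapsDense.isPreradical (hR : R.MapsDense) : R.IsPreradical where
  isIdeal L _ := by
    intro x y hy
    refine lie_mem_of_innerAut_mem (T := (R L).toLieSubalgebra.toSubmodule) (R L).isClosed
      fun t => ?_
    have hs : Function.Surjective (innerAut (t • x)) := fun z =>
      ⟨innerAut (-(t • x)) z, innerAut_innerAut_neg _ _⟩
    exact hR _ _ _ (continuous_innerAut _) hs.denseRange _ hy
  map_mem := hR

theorem IsPreradical.isIdeal_series (hR : R.IsPreradical) (L : Type u) [BanachLieAlgebra L]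
    (α : Ordinal.{u}) : (R.series L α).IsIdeal := by
  induction α using Ordinal.limitRecOn with
  | zero =>
    rw [series_zero]
    exact fun _ _ _ => LieSubalgebra.mem_top _
  | add_one α ih =>
    rw [series_succ]
    exact MapsDense.isIdeal_ofSub hR.map_mem ih
  | limit α hα ih =>
    rw [series_limit R L hα]
    intro x y hy
    rw [ClosedLieSubalgebra.mem_sInf] at hy ⊢
    rintro _ ⟨β, hβ, rfl⟩
    exact ih β hβ x y (hy _ ⟨β, hβ, rfl⟩)

/-- `R I ⊆ R L` for closed ideals `I` of `L`. -/
def IsBalanced (R : SubalgebraMap.{u}) : Prop :=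
  ∀ (L : Type u) [BanachLieAlgebra L] (I : ClosedLieSubalgebra L), I.IsIdeal →
    I.ofSub (R I.toLieSubalgebra) ≤ R L

/-- The inclusion of `A` into `B`. -/
noncomputable def _root_.ClosedLieSubalgebra.inclusion {L : Type u} [BanachLieAlgebra L]
    {A B : ClosedLieSubalgebra L} (h : A ≤ B) : A.toLieSubalgebra →ₗ⁅ℂ⁆ B.toLieSubalgebra :=
  lift A.toLieSubalgebra.incl B fun x => h x.2

theorem _root_.ClosedLieSubalgebra.continuous_inclusion {L : Type u} [BanachLieAlgebra L]
    {A B : ClosedLieSubalgebra L} (h : A ≤ B) : Continuous (inclusion h) :=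
  continuous_lift (continuous_incl A) B _

theorem IsBalanced.map_mem (hb : R.IsBalanced) (hR : R.MapsDense) {N L : Type u}
    [BanachLieAlgebra N] [BanachLieAlgebra L] {f : N →ₗ⁅ℂ⁆ L} (hf : Continuous f)
    {I : ClosedLieSubalgebra L} (hI : I.IsIdeal) (hfI : ∀ y, y ∈ I.toLieSubalgebra ↔ ∃ x, f x = y)
    {x : N} (hx : x ∈ (R N).toLieSubalgebra) : f x ∈ (R L).toLieSubalgebra := by
  have hfx : ∀ x, f x ∈ I.toLieSubalgebra := fun x => (hfI _).2 ⟨x, rfl⟩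
  have hs : Function.Surjective (lift f I hfx) := fun z => by
    obtain ⟨x, hx⟩ := (hfI z.1).1 z.2
    exact ⟨x, Subtype.ext hx⟩
  have h1 := hR _ _ (lift f I hfx) (continuous_lift hf I hfx) hs.denseRange x hx
  exact hb L I hI (mem_ofSub.2 ⟨hfx x, h1⟩)

theorem ofSub_le_ofSub (hR : R₁.MapsDense) (hb : R₁.IsBalanced)
    (hle : ∀ (L : Type u) [BanachLieAlgebra L], R₁ L ≤ R₂ L) {L : Type u} [BanachLieAlgebra L]
    {A B : ClosedLieSubalgebra L} (hA : A.IsIdeal) (hAB : A ≤ B) :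
    A.ofSub (R₁ A.toLieSubalgebra) ≤ B.ofSub (R₂ B.toLieSubalgebra) := by
  intro x hx
  obtain ⟨hxA, hxR⟩ := mem_ofSub.1 hx
  have hI : (ClosedLieSubalgebra.comap B.toLieSubalgebra.incl (continuous_incl B) A).IsIdeal :=
    hA.comap
  have h1 := hb.map_mem hR (continuous_inclusion hAB) hI
    (fun y => ⟨fun hy => ⟨⟨y.1, hy⟩, rfl⟩, by rintro ⟨z, rfl⟩; exact z.2⟩) hxR
  exact mem_ofSub.2 ⟨hAB hxA, hle _ h1⟩

/-- At a successor, R₁(A) ⊆ R₁(B) ⊆ R₂(B) for the ideal A ⊆ B; the first inclusion is where balance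
enters. -/
theorem series_le_series (h₁ : R₁.IsPreradical) (hb : R₁.IsBalanced)
    (hle : ∀ (L : Type u) [BanachLieAlgebra L], R₁ L ≤ R₂ L) (L : Type u) [BanachLieAlgebra L]
    (α : Ordinal.{u}) : R₁.series L α ≤ R₂.series L α := by
  induction α using Ordinal.limitRecOn with
  | zero => rw [series_zero, series_zero]
  | add_one α ih =>
    rw [series_succ, series_succ]
    exact ofSub_le_ofSub h₁.map_mem hb hle (h₁.isIdeal_series L α) ih
  | limit α hα ih =>
    rw [series_limit R₁ L hα, series_limit R₂ L hα]
    intro x hx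
    rw [ClosedLieSubalgebra.mem_sInf] at hx ⊢
    rintro _ ⟨β, hβ, rfl⟩
    exact ih β hβ (hx _ ⟨β, hβ, rfl⟩)

end SubalgebraMap

/-! ### The four families and their intersections -/

open ClosedLieSubalgebra SubalgebraMap

section Families

variable {L : Type u} [BanachLieAlgebra L]

theorem properIdeals_subset : properIdeals L ⊆ properSubalgebras L := fun _ hS => hS.2

theorem exists_mem_maximalSubalgebras {S : ClosedLieSubalgebra L} (hS : S ∈ properSubalgebras L) :
    ∃ T ∈ maximalSubalgebras L, S ≤ T := by
  obtain ⟨T, hle, hT⟩ := exists_le_maximal (p := (· ≠ ⊤)) hS.1 hS.2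
  exact ⟨T, ⟨hT, hS.2.mono hle⟩, hle⟩

theorem exists_mem_maximalIdeals {S : ClosedLieSubalgebra L} (hS : S ∈ properIdeals L) :
    ∃ T ∈ maximalIdeals L, S ≤ T := by
  obtain ⟨T, hle, hT⟩ := exists_le_maximal (p := fun T => T.IsIdeal ∧ T ≠ ⊤) ⟨hS.1, hS.2.1⟩ hS.2.2
  exact ⟨T, ⟨hT, hS.2.2.mono hle⟩, hle⟩

theorem exists_mem_properIdeals_le {S : ClosedLieSubalgebra L} (hS : S ∈ maximalSubalgebras L) :
    ∃ I ∈ properIdeals L, I ≤ S := by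
  obtain ⟨I, hI, hle, hfin⟩ := exists_isIdeal_le_of_maximal hS.1 hS.2
  refine ⟨I, ⟨hI, fun h => hS.1.1 (eq_top_of_forall_mem fun x => hle ?_), hfin⟩, hle⟩
  exact mem_of_eq_top h x

theorem sInf_le_of_mem {F : Set (ClosedLieSubalgebra L)} {S : ClosedLieSubalgebra L} (hS : S ∈ F) :
    sInf F ≤ S := fun _ hx => ClosedLieSubalgebra.mem_sInf.1 hx S hS

/-- A proper subalgebra of finite codimension lies in a maximal one, which contains an ideal of
finite codimension, which lies in a maximal ideal. -/
theorem preradJmax_ne_top (h : (properSubalgebras L).Nonempty) : preradJmax L ≠ ⊤ := by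
  obtain ⟨S, hS⟩ := h
  obtain ⟨T, hT, -⟩ := exists_mem_maximalSubalgebras hS
  obtain ⟨I, hI, -⟩ := exists_mem_properIdeals_le hT
  obtain ⟨J, hJ, -⟩ := exists_mem_maximalIdeals hI
  intro h
  exact hJ.1.1.2 (eq_top_of_forall_mem fun x => sInf_le_of_mem hJ (mem_of_eq_top h x))

end Families

theorem mapsDense_preradS : preradS.{u}.MapsDense := by
  intro L M _ _ f hf hd x hx
  refine ClosedLieSubalgebra.mem_sInf.2 fun S hS => ?_
  exact ClosedLieSubalgebra.mem_sInf.1 hx (ClosedLieSubalgebra.comap f hf S)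
    ⟨comap_ne_top hd hS.1, hS.2.comap⟩

theorem mapsDense_preradJ : preradJ.{u}.MapsDense := by
  intro L M _ _ f hf hd x hx
  refine ClosedLieSubalgebra.mem_sInf.2 fun S hS => ?_
  exact ClosedLieSubalgebra.mem_sInf.1 hx (ClosedLieSubalgebra.comap f hf S)
    ⟨hS.1.comap, comap_ne_top hd hS.2.1, hS.2.2.comap⟩

theorem mapsDense_preradSmax : preradSmax.{u}.MapsDense := by
  intro L M _ _ f hf hd x hx
  refine ClosedLieSubalgebra.mem_sInf.2 fun S hS => ?_
  exact ClosedLieSubalgebra.mem_sInf.1 hx (ClosedLieSubalgebra.comap f hf S)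
    (comap_mem_maximalSubalgebras hd hS)

theorem mapsDense_preradJmax : preradJmax.{u}.MapsDense := by
  intro L M _ _ f hf hd x hx
  refine ClosedLieSubalgebra.mem_sInf.2 fun S hS => ?_
  exact ClosedLieSubalgebra.mem_sInf.1 hx (ClosedLieSubalgebra.comap f hf S)
    (comap_mem_maximalIdeals hd hS)

theorem preradS_le_preradJ (L : Type u) [BanachLieAlgebra L] : preradS L ≤ preradJ L :=
  fun _ hx => ClosedLieSubalgebra.mem_sInf.2 fun S hS =>
    ClosedLieSubalgebra.mem_sInf.1 hx S (properIdeals_subset hS)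

theorem preradJ_le_preradSmax (L : Type u) [BanachLieAlgebra L] : preradJ L ≤ preradSmax L := by
  intro x hx
  refine ClosedLieSubalgebra.mem_sInf.2 fun S hS => ?_
  obtain ⟨I, hI, hle⟩ := exists_mem_properIdeals_le hS
  exact hle (ClosedLieSubalgebra.mem_sInf.1 hx I hI)

/-- The sum of a closed ideal of finite codimension and a closed subalgebra. -/
def ClosedLieSubalgebra.supIdeal {L : Type u} [BanachLieAlgebra L] (S P : ClosedLieSubalgebra L)
    (hS : S.FiniteCodim) (hP : P.IsIdeal) : ClosedLieSubalgebra L where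
  toLieSubalgebra :=
    { S.toLieSubalgebra.toSubmodule ⊔ P.toLieSubalgebra.toSubmodule with
      lie_mem' := by
        intro a b ha hb
        obtain ⟨s, hs, p, hp, rfl⟩ := Submodule.mem_sup.1 ha
        obtain ⟨t, ht, q, hq, rfl⟩ := Submodule.mem_sup.1 hb
        rw [lie_add, add_lie, add_assoc]
        refine add_mem (Submodule.mem_sup_left (S.toLieSubalgebra.lie_mem hs ht))
          (Submodule.mem_sup_right (add_mem ?_ (hP _ _ hq)))
        rw [← lie_skew]
        exact neg_mem (hP t p hp) }
  -- `S` is the summand of finite codimension and `P` the ideal; no codimension condition on `P` is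
  -- needed.
  isClosed := isClosed_of_finiteCodim hS le_sup_left

section supIdeal

variable {L : Type u} [BanachLieAlgebra L] {S P : ClosedLieSubalgebra L} (hS : S.FiniteCodim)
  (hP : P.IsIdeal)

theorem ClosedLieSubalgebra.mem_supIdeal {x : L} : x ∈ (supIdeal S P hS hP).toLieSubalgebra ↔
    ∃ s ∈ S.toLieSubalgebra, ∃ p ∈ P.toLieSubalgebra, s + p = x :=
  Submodule.mem_sup

theorem ClosedLieSubalgebra.le_supIdeal_left : S ≤ supIdeal S P hS hP :=
  fun x hx => (mem_supIdeal hS hP).2 ⟨x, hx, 0, zero_mem _, add_zero x⟩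

theorem ClosedLieSubalgebra.le_supIdeal_right : P ≤ supIdeal S P hS hP :=
  fun x hx => (mem_supIdeal hS hP).2 ⟨0, zero_mem _, x, hx, zero_add x⟩

theorem ClosedLieSubalgebra.isIdeal_supIdeal (hSI : S.IsIdeal) : (supIdeal S P hS hP).IsIdeal := by
  intro x y hy
  obtain ⟨s, hs, p, hp, rfl⟩ := (mem_supIdeal hS hP).1 hy
  exact (mem_supIdeal hS hP).2 ⟨_, hSI x s hs, _, hP x p hp, (lie_add _ _ _).symm⟩

end supIdeal

/-- Let P be the intersection of the maximal subalgebras. If P is not in a maximal ideal I, then I +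
P = L. But a maximal subalgebra above I contains P as well, a contradiction. -/
theorem preradSmax_le_preradJmax (L : Type u) [BanachLieAlgebra L] :
    preradSmax L ≤ preradJmax L := by
  intro x hx
  refine ClosedLieSubalgebra.mem_sInf.2 fun I hI => ?_
  have hP : (preradSmax L).IsIdeal := mapsDense_preradSmax.isPreradical.isIdeal L
  by_contra hxI
  have htop : supIdeal I (preradSmax L) hI.2 hP = ⊤ := by
    by_contra hne
    exact hxI (hI.1.2 ⟨isIdeal_supIdeal hI.2 hP hI.1.1.1, hne⟩ (le_supIdeal_left hI.2 hP)
      (le_supIdeal_right hI.2 hP hx))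
  obtain ⟨T, hT, hIT⟩ := exists_mem_maximalSubalgebras (S := I) ⟨hI.1.1.2, hI.2⟩
  refine hT.1.1 (eq_top_of_forall_mem fun y => ?_)
  obtain ⟨s, hs, p, hp, rfl⟩ := (mem_supIdeal hI.2 hP).1 (mem_of_eq_top htop y)
  exact add_mem (hIT hs) (sInf_le_of_mem hT hp)

/-- Density of the image is not needed: a preimage that is the whole algebra imposes no condition.
Applied to inclusions this gives balance. -/
theorem map_mem_preradS {N L : Type u} [BanachLieAlgebra N] [BanachLieAlgebra L] {f : N →ₗ⁅ℂ⁆ L}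
    (hf : Continuous f) {x : N} (hx : x ∈ (preradS N).toLieSubalgebra) :
    f x ∈ (preradS L).toLieSubalgebra := by
  refine ClosedLieSubalgebra.mem_sInf.2 fun S hS => ?_
  by_cases h : ClosedLieSubalgebra.comap f hf S = ⊤
  · exact mem_of_eq_top h x
  · exact ClosedLieSubalgebra.mem_sInf.1 hx _ ⟨h, hS.2.comap⟩

theorem map_mem_preradJ {N L : Type u} [BanachLieAlgebra N] [BanachLieAlgebra L] {f : N →ₗ⁅ℂ⁆ L}
    (hf : Continuous f) {x : N} (hx : x ∈ (preradJ N).toLieSubalgebra) :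
    f x ∈ (preradJ L).toLieSubalgebra := by
  refine ClosedLieSubalgebra.mem_sInf.2 fun S hS => ?_
  by_cases h : ClosedLieSubalgebra.comap f hf S = ⊤
  · exact mem_of_eq_top h x
  · exact ClosedLieSubalgebra.mem_sInf.1 hx _ ⟨hS.1.comap, h, hS.2.2.comap⟩

theorem isBalanced_preradS : preradS.{u}.IsBalanced := by
  intro L _ I _ x hx
  obtain ⟨h, hx⟩ := mem_ofSub.1 hx
  exact map_mem_preradS (continuous_incl I) hx

theorem isBalanced_preradJ : preradJ.{u}.IsBalanced := by
  intro L _ I _ x hx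
  obtain ⟨h, hx⟩ := mem_ofSub.1 hx
  exact map_mem_preradJ (continuous_incl I) hx

/-- Let P be the value on the ideal I; it is an ideal of L. If a maximal S misses part of P, then S
+ P = L, so I = (S ∩ I) + P. Since S ∩ I is proper in I, it lies in a maximal subalgebra of I, which
also contains P: a contradiction. -/
theorem isBalanced_preradSmax : preradSmax.{u}.IsBalanced := by
  intro L _ I hI x hx
  refine ClosedLieSubalgebra.mem_sInf.2 fun S hS => ?_
  have hP := mapsDense_preradSmax.isIdeal_ofSub hI
  by_contra hxS
  have htop : supIdeal S _ hS.2 hP = ⊤ := by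
    by_contra hne
    exact hxS (hS.1.2 hne (le_supIdeal_left hS.2 hP) (le_supIdeal_right hS.2 hP hx))
  let T := ClosedLieSubalgebra.comap I.toLieSubalgebra.incl (continuous_incl I) S
  by_cases hT : T = ⊤
  · exact hxS (mem_of_eq_top hT (⟨x, (mem_ofSub.1 hx).1⟩ : I.toLieSubalgebra))
  · obtain ⟨T', hT', hle⟩ := exists_mem_maximalSubalgebras (S := T) ⟨hT, hS.2.comap⟩
    refine hT'.1.1 (eq_top_of_forall_mem fun y => ?_)
    obtain ⟨s, hs, p, hp, hy⟩ := (mem_supIdeal hS.2 hP).1 (mem_of_eq_top htop y.1)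
    obtain ⟨hpI, hpR⟩ := mem_ofSub.1 hp
    have hpT : (⟨p, hpI⟩ : I.toLieSubalgebra) ∈ T'.toLieSubalgebra := sInf_le_of_mem hT' hpR
    have hsT : y - ⟨p, hpI⟩ ∈ T'.toLieSubalgebra := by
      refine hle ?_
      change y.1 - p ∈ S.toLieSubalgebra
      rwa [← hy, add_sub_cancel_right]
    have := add_mem hsT hpT
    rwa [sub_add_cancel] at this

/-! ### The universal property of the superposition -/

namespace SubalgebraMap

/-- A map above `preradS` that is proper on every algebra with proper closed subalgebras of finite
codimension. -/
structure DetectsFiniteCodim (R : SubalgebraMap.{u}) : Prop where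
  preradS_le : ∀ (L : Type u) [BanachLieAlgebra L], preradS L ≤ R L
  eq_empty : ∀ (L : Type u) [BanachLieAlgebra L], R L = ⊤ → properSubalgebras L = ∅

variable {R R₁ R₂ : SubalgebraMap.{u}}

theorem map_mem_preradS_of_eq_empty {N L : Type u} [BanachLieAlgebra N] [BanachLieAlgebra L]
    (hN : properSubalgebras N = ∅) {f : N →ₗ⁅ℂ⁆ L} (hf : Continuous f) (x : N) :
    f x ∈ (preradS L).toLieSubalgebra :=
  map_mem_preradS hf (ClosedLieSubalgebra.mem_sInf.2 fun S hS => by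
    rw [hN] at hS
    exact hS.elim)

namespace DetectsFiniteCodim

/-- At a successor, `f` is corestricted to the current step; its image lies in `preradS` of that
step because `N` has no proper subalgebras to test, and `preradS` lies below `R`. -/
theorem map_mem_series (hR : R.DetectsFiniteCodim) {N L : Type u} [BanachLieAlgebra N]
    [BanachLieAlgebra L] (hN : properSubalgebras N = ∅) {f : N →ₗ⁅ℂ⁆ L} (hf : Continuous f)
    (α : Ordinal.{u}) : ∀ x, f x ∈ (R.series L α).toLieSubalgebra := by
  induction α using Ordinal.limitRecOn with
  | zero =>
    rw [series_zero]
    exact fun x => LieSubalgebra.mem_top _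
  | add_one α ih =>
    rw [series_succ]
    intro x
    exact mem_ofSub.2 ⟨ih x, hR.preradS_le _
      (map_mem_preradS_of_eq_empty hN (continuous_lift hf _ ih) x)⟩
  | limit α hα ih =>
    rw [series_limit R L hα]
    intro x
    rw [ClosedLieSubalgebra.mem_sInf]
    rintro _ ⟨β, hβ, rfl⟩
    exact ih β hβ x

theorem properSubalgebras_superposition (hR : R.DetectsFiniteCodim) (L : Type u)
    [BanachLieAlgebra L] : properSubalgebras (R.superposition L).toLieSubalgebra = ∅ := by
  refine hR.eq_empty _ (eq_top_of_forall_mem fun x => ?_)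
  have h := R.series_length_add_one L
  rw [series_succ] at h
  have hx : x.1 ∈ (R.series L (R.length L)).toLieSubalgebra := x.2
  rw [← h] at hx
  exact (mem_ofSub.1 hx).2

theorem map_mem_superposition (hR : R.DetectsFiniteCodim) {N L : Type u} [BanachLieAlgebra N]
    [BanachLieAlgebra L] (hN : properSubalgebras N = ∅) {f : N →ₗ⁅ℂ⁆ L} (hf : Continuous f) (x : N) :
    f x ∈ (R.superposition L).toLieSubalgebra :=
  hR.map_mem_series hN hf _ x

theorem superposition_le_series (h₁ : R₁.DetectsFiniteCodim) (h₂ : R₂.DetectsFiniteCodim)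
    (L : Type u) [BanachLieAlgebra L] (α : Ordinal.{u}) :
    R₁.superposition L ≤ R₂.series L α := fun x hx =>
  h₂.map_mem_series (h₁.properSubalgebras_superposition L)
    (continuous_incl (R₁.superposition L)) α ⟨x, hx⟩

theorem superposition_eq (h₁ : R₁.DetectsFiniteCodim) (h₂ : R₂.DetectsFiniteCodim) :
    R₁.superposition = R₂.superposition := by
  funext L _
  exact le_antisymm (h₁.superposition_le_series h₂ L _) (h₂.superposition_le_series h₁ L _)

/-- At the length of the larger series the smaller one is squeezed between the common final value
and itself, so it has already stabilized. -/
theorem length_le_length (h₁ : R₁.DetectsFiniteCodim) (h₂ : R₂.DetectsFiniteCodim) {L : Type u}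
    [BanachLieAlgebra L] (hle : ∀ α, R₁.series L α ≤ R₂.series L α) :
    R₁.length L ≤ R₂.length L := by
  refine csInf_le' (le_antisymm (series_antitone R₁ L (Order.le_succ _)) ?_)
  refine (hle _).trans ?_
  exact h₂.superposition_le_series h₁ L _

theorem mapsDense_superposition (hR : R.DetectsFiniteCodim) : R.superposition.MapsDense := by
  intro L M _ _ f hf _ x hx
  exact hR.map_mem_superposition (hR.properSubalgebras_superposition L)
    (f := f.comp (R.superposition L).toLieSubalgebra.incl)
    (Continuous.comp (g := f) hf (continuous_incl (R.superposition L))) ⟨x, hx⟩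

end DetectsFiniteCodim

end SubalgebraMap

/-! ### Quotients and extensions -/

namespace ClosedLieSubalgebra

variable {L : Type u} [BanachLieAlgebra L]

/-- The quotient homomorphism. -/
noncomputable def quotientMap (S : ClosedLieSubalgebra L) (hS : S.IsIdeal) :
    L →ₗ⁅ℂ⁆ L ⧸ S.toLieIdeal hS where
  toLinearMap := (S.toLieIdeal hS).toSubmodule.mkQ
  map_lie' := rfl

variable {S : ClosedLieSubalgebra L} (hS : S.IsIdeal)

theorem quotientMap_surjective : Function.Surjective (S.quotientMap hS) :=
  Submodule.Quotient.mk_surjective _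

theorem continuous_quotientMap : Continuous (S.quotientMap hS) :=
  continuous_quot_mk

theorem quotientMap_eq_iff {x y : L} :
    S.quotientMap hS x = S.quotientMap hS y ↔ x - y ∈ S.toLieSubalgebra :=
  Submodule.Quotient.eq (S.toLieIdeal hS).toSubmodule

/-- The image in the quotient of a closed Lie subalgebra containing the ideal. -/
noncomputable def mapQuotient (T : ClosedLieSubalgebra L) (h : S ≤ T) :
    ClosedLieSubalgebra (L ⧸ S.toLieIdeal hS) where
  toLieSubalgebra := T.toLieSubalgebra.map (S.quotientMap hS)
  isClosed := by
    have hq : Topology.IsQuotientMap (S.quotientMap hS) := isQuotientMap_quot_mk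
    refine hq.isClosed_preimage.1 ?_
    convert T.isClosed using 1
    ext x
    constructor
    · rintro ⟨y, hy, hyx⟩
      have := add_mem (h ((quotientMap_eq_iff hS).1 hyx.symm)) hy
      rwa [sub_add_cancel] at this
    · exact fun hx => ⟨x, hx, rfl⟩

/-- Having no proper closed subalgebras of finite codimension is stable under extensions. -/
theorem properSubalgebras_comap_quotientMap (hS₀ : properSubalgebras S.toLieSubalgebra = ∅)
    {N : ClosedLieSubalgebra (L ⧸ S.toLieIdeal hS)}
    (hN : properSubalgebras N.toLieSubalgebra = ∅) :
    properSubalgebras (comap (S.quotientMap hS) (continuous_quotientMap hS) N).toLieSubalgebra =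
      ∅ := by
  set P := comap (S.quotientMap hS) (continuous_quotientMap hS) N with hP
  rw [Set.eq_empty_iff_forall_notMem]
  rintro T ⟨hTtop, hTfin⟩
  have hSP : ∀ x : S.toLieSubalgebra, S.toLieSubalgebra.incl x ∈ P.toLieSubalgebra := by
    intro x
    have h0 : S.quotientMap hS x.1 = S.quotientMap hS 0 :=
      (quotientMap_eq_iff hS).2 (by rw [sub_zero]; exact x.2)
    rw [hP, mem_comap]
    change S.quotientMap hS x.1 ∈ _
    rw [h0, map_zero]
    exact zero_mem _
  -- `S` has no proper closed subalgebra of finite codimension, so its trace on `T` is all of `S`.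
  -- Thus `T` is determined by its image in `N`, which must be all of `N`.
  have hST : S ≤ P.ofSub T := fun x hx => mem_ofSub.2 ⟨hSP ⟨x, hx⟩,
    sInf_le_of_mem (F := properSubalgebras P.toLieSubalgebra) ⟨hTtop, hTfin⟩
      (map_mem_preradS_of_eq_empty hS₀ (continuous_lift (continuous_incl S) P hSP) ⟨x, hx⟩)⟩
  let T' : ClosedLieSubalgebra N.toLieSubalgebra :=
    comap N.toLieSubalgebra.incl (continuous_incl N) (mapQuotient hS (P.ofSub T) hST)
  let g : P.toLieSubalgebra →ₗ⁅ℂ⁆ N.toLieSubalgebra :=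
    lift ((S.quotientMap hS).comp P.toLieSubalgebra.incl) N fun x => x.2
  have hgs : Function.Surjective g := by
    rintro ⟨y, hy⟩
    obtain ⟨x, rfl⟩ := quotientMap_surjective hS y
    exact ⟨⟨x, hy⟩, rfl⟩
  have hgT : ∀ x, x ∈ T.toLieSubalgebra → g x ∈ T'.toLieSubalgebra := fun x hx =>
    ⟨x.1, mem_ofSub.2 ⟨x.2, hx⟩, rfl⟩
  have hT'fin : T'.FiniteCodim := by
    have : Module.Finite ℂ (P.toLieSubalgebra ⧸ T.toLieSubalgebra.toSubmodule) := hTfin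
    refine Module.Finite.of_surjective (Submodule.mapQ T.toLieSubalgebra.toSubmodule
      T'.toLieSubalgebra.toSubmodule (g : P.toLieSubalgebra →ₗ[ℂ] N.toLieSubalgebra) hgT) ?_
    intro y
    obtain ⟨y, rfl⟩ := Submodule.Quotient.mk_surjective _ y
    obtain ⟨x, rfl⟩ := hgs y
    exact ⟨Submodule.Quotient.mk x, rfl⟩
  have hT'top : T' = ⊤ := by
    by_contra h
    have : T' ∈ properSubalgebras N.toLieSubalgebra := ⟨h, hT'fin⟩
    rw [hN] at this
    exact this
  refine hTtop (eq_top_of_forall_mem fun x => ?_)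
  obtain ⟨y, hy, hyx⟩ := mem_of_eq_top hT'top (g x)
  have := add_mem (hST ((quotientMap_eq_iff hS).1 hyx.symm)) hy
  rw [sub_add_cancel] at this
  exact (mem_ofSub.1 this).2

end ClosedLieSubalgebra

/-! ### The radical axioms and the main theorem -/

theorem SubalgebraMap.DetectsFiniteCodim.isRadical_superposition {R : SubalgebraMap.{u}}
    (hR : R.DetectsFiniteCodim) : R.superposition.IsRadical where
  toIsPreradical := hR.mapsDense_superposition.isPreradical
  lowerStable L _ := by
    refine le_antisymm (ofSub_le _ _) fun x hx => mem_ofSub.2 ⟨hx, ?_⟩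
    exact hR.map_mem_superposition (hR.properSubalgebras_superposition L)
      (f := LieHom.id) continuous_id ⟨x, hx⟩
  upperStable L _ := by
    set hI := hR.mapsDense_superposition.isPreradical.isIdeal L
    refine le_antisymm (fun y hy => ?_) fun y hy => ?_
    · obtain ⟨x, rfl⟩ := quotientMap_surjective hI y
      -- The preimage in `L` of the radical of the quotient is an extension of two algebras without
      -- proper closed subalgebras of finite codimension, so it lies in the radical of `L`.
      have hP := properSubalgebras_comap_quotientMap hI (hR.properSubalgebras_superposition L)
        (hR.properSubalgebras_superposition (L ⧸ (R.superposition L).toLieIdeal hI))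
      have hx : x ∈ (R.superposition L).toLieSubalgebra :=
        hR.map_mem_superposition hP (continuous_incl _) ⟨x, hy⟩
      have h0 : (R.superposition L).quotientMap hI x = (R.superposition L).quotientMap hI 0 :=
        (quotientMap_eq_iff hI).2 (by rwa [sub_zero])
      rw [h0, map_zero]
      exact zero_mem _
    · have h0 : y = 0 := hy
      rw [h0]
      exact zero_mem _
  balanced L _ I _ x hx := by
    obtain ⟨hxI, hx⟩ := mem_ofSub.1 hx
    exact hR.map_mem_superposition (hR.properSubalgebras_superposition I.toLieSubalgebra)
      (f := I.toLieSubalgebra.incl.comp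
        (R.superposition I.toLieSubalgebra).toLieSubalgebra.incl)
      (Continuous.comp (g := I.toLieSubalgebra.incl) (continuous_incl I) (continuous_incl _))
      ⟨⟨x, hxI⟩, hx⟩

theorem SubalgebraMap.DetectsFiniteCodim.of_le {R : SubalgebraMap.{u}}
    (h₁ : ∀ (L : Type u) [BanachLieAlgebra L], preradS L ≤ R L)
    (h₂ : ∀ (L : Type u) [BanachLieAlgebra L], R L ≤ preradJmax L) : R.DetectsFiniteCodim where
  preradS_le := h₁
  eq_empty L _ h := by
    by_contra hne
    refine preradJmax_ne_top (Set.nonempty_iff_ne_empty.2 hne) (eq_top_of_forall_mem fun x => ?_)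
    exact h₂ L (mem_of_eq_top h x)

theorem theorem7p8 :
    (∀ (L : Type u) [BanachLieAlgebra L],
      preradS L ≤ preradJ L ∧ preradJ L ≤ preradSmax L ∧ preradSmax L ≤ preradJmax L ∧
      ((properSubalgebras L).Nonempty → preradJmax L ≠ ⊤)) ∧
    (preradS.{u}.IsPreradical ∧ preradJ.{u}.IsPreradical ∧
      preradSmax.{u}.IsPreradical ∧ preradJmax.{u}.IsPreradical) ∧
    (frattiniRadical.{u}.IsRadical ∧
      preradS.{u}.superposition = frattiniRadical ∧
      preradJ.{u}.superposition = frattiniRadical ∧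
      preradSmax.{u}.superposition = frattiniRadical ∧
      preradJmax.{u}.superposition = frattiniRadical) ∧
    (∀ (L : Type u) [BanachLieAlgebra L],
      preradS.length L ≤ preradJ.length L ∧
      preradJ.length L ≤ preradSmax.length L ∧
      preradSmax.length L ≤ preradJmax.length L) := by
  have hS : preradS.{u}.DetectsFiniteCodim := .of_le (fun _ _ => le_rfl) fun L _ =>
    (preradS_le_preradJ L).trans ((preradJ_le_preradSmax L).trans (preradSmax_le_preradJmax L))
  have hJ : preradJ.{u}.DetectsFiniteCodim := .of_le (fun L _ => preradS_le_preradJ L) fun L _ =>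
    (preradJ_le_preradSmax L).trans (preradSmax_le_preradJmax L)
  have hSm : preradSmax.{u}.DetectsFiniteCodim :=
    .of_le (fun L _ => (preradS_le_preradJ L).trans (preradJ_le_preradSmax L))
      fun L _ => preradSmax_le_preradJmax L
  have hJm : preradJmax.{u}.DetectsFiniteCodim :=
    .of_le (fun L _ => (preradS_le_preradJ L).trans
      ((preradJ_le_preradSmax L).trans (preradSmax_le_preradJmax L))) fun _ _ => le_rfl
  refine ⟨fun L _ => ⟨preradS_le_preradJ L, preradJ_le_preradSmax L, preradSmax_le_preradJmax L,
    preradJmax_ne_top⟩, ⟨mapsDense_preradS.isPreradical, mapsDense_preradJ.isPreradical,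
    mapsDense_preradSmax.isPreradical, mapsDense_preradJmax.isPreradical⟩,
    ⟨hS.isRadical_superposition, rfl, hJ.superposition_eq hS, hSm.superposition_eq hS,
    hJm.superposition_eq hS⟩, fun L _ => ⟨?_, ?_, ?_⟩⟩
  · exact hS.length_le_length hJ (series_le_series mapsDense_preradS.isPreradical
      isBalanced_preradS (fun L _ => preradS_le_preradJ L) L)
  · exact hJ.length_le_length hSm (series_le_series mapsDense_preradJ.isPreradical
      isBalanced_preradJ (fun L _ => preradJ_le_preradSmax L) L)
  · exact hSm.length_le_length hJm (series_le_series mapsDense_preradSmax.isPreradical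
      isBalanced_preradSmax (fun L _ => preradSmax_le_preradJmax L) L)
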